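/- \textbf{Setting.} Bit strings of length $t$ are elements of $\mathbf F_2^t$; $|c|$ is the number of $1$-bits of $c$ and $d_H$ the Hamming distance. Let $|0^0\rangle,|1^0\rangle$ be the computational ($z$) basis of the qubit space and $|0^1\rangle=\frac{|0^0\rangle+|1^0\rangle}{\sqrt2}$, $|1^1\rangle=\frac{|0^0\rangle-|1^0\rangle}{\sqrt2}$ the $x$ basis. Let $n,n_z,n_x,m\ge 1$ and $r\ge 0$ be integers, $N=n+n_z+n_x$, and let $p_{a,z},p_{a,x}$ be real numbers. Let $P_C$ be an $r\times n$ matrix and $P_K$ an $m\times n$ matrix over $\mathbf F_2$ such that the $r+m$ rows $v_1,\dots,v_r$ (of $P_C$), $v_{r+1},\dots,v_{r+m}$ (of $P_K$) are linearly independent. With $V_{r'}=\operatorname{Span}\{v_1,\dots,v_{r'}\}$ put $$d_{r,m}=\min_{r\le r'<r+m} d_H(v_{r'+1},V_{r'}).$$ \textbf{Protocol (BB84-INFO-$z$).} Alice chooses uniformly at random a partition $\mathcal P=(\mathbf s,\mathbf z,\mathbf b)$, i.e. three strings in $\mathbf F_2^N$ with $|\mathbf s|=n$, $|\mathbf z|=n_z$,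 $|\mathbf b|=n_x$, $|\mathbf s+\mathbf z+\mathbf b|=N$ (the positions of their $1$-bits are the INFO, TEST-Z and TEST-X bits), and, independently and uniformly, a string $\mathbf i\in\mathbf F_2^N$. She sends the qubits $|i_1^{b_1}\rangle,\dots,|i_N^{b_N}\rangle$; Bob measures the $j$-th received qubit in the basis $\{|0^{b_j}\rangle,|1^{b_j}\rangle\}$ and gets $i^B_j$. Let $\mathbf c=\mathbf i+\mathbf i^B$, and let $\mathbf c_{\mathbf s},\mathbf c_{\mathbf z},\mathbf c_{\mathbf b}$ be its substrings on the INFO, TEST-Z and TEST-X bits. Alice publishes the syndrome $\xi=\mathbf xP_C^{T}$ of the INFO string $\mathbf x=\mathbf i_{\mathbf s}$; the final key is $\mathbf xP_K^{T}\in\mathbf F_2^m$. \textbf{Attack.} Eve performs a collective attack, chosen independently of $\mathbf i$ and $\mathcal P$: for each $j$ she attaches to the $j$-th qubit a probe in a normalized pure state $|0^E\rangle_{E_j}$ of a finite-dimensional space of her choice, applies a unitary $U_j$ of her choice to the probe and the qubit, keeps the probe, and sends the qubit on to Bob. Given $\mathcal P$, let $\rho_{\mathbf x}$ be the resulting state of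 her probes of the INFO bits if Alice sent the INFO string $\mathbf x$ (the tensor product of the reduced probe states), and for a syndrome $\xi\in\mathbf F_2^r$ and a key $\mathbf k\in\mathbf F_2^m$ let $$\widehat\rho_{\mathbf k}=\frac1{2^{n-r-m}}\sum_{\mathbf x:\ \mathbf xP_C^{T}=\xi,\ \mathbf xP_K^{T}=\mathbf k}\rho_{\mathbf x}.$$ For two keys $\mathbf k,\mathbf k'$ define $\Delta_{\rm Eve}(\mathbf k,\mathbf k'\mid\mathcal P,\xi,\mathbf c_{\mathbf z},\mathbf c_{\mathbf b})=\frac12\operatorname{tr}|\widehat\rho_{\mathbf k}-\widehat\rho_{\mathbf k'}|$ if $\frac{|\mathbf c_{\mathbf z}|}{n_z}\le p_{a,z}$ and $\frac{|\mathbf c_{\mathbf b}|}{n_x}\le p_{a,x}$, and $\Delta_{\rm Eve}=0$ otherwise, and let $$\langle\Delta_{\rm Eve}(\mathbf k,\mathbf k')\rangle=\sum_{\mathcal P,\xi,\mathbf c_{\mathbf z},\mathbf c_{\mathbf b}}\Delta_{\rm Eve}(\mathbf k,\mathbf k'\mid\mathcal P,\xi,\mathbf c_{\mathbf z},\mathbf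 c_{\mathbf b})\;p(\mathcal P,\xi,\mathbf c_{\mathbf z},\mathbf c_{\mathbf b}),$$ where $p(\mathcal P,\xi,\mathbf c_{\mathbf z},\mathbf c_{\mathbf b})$ is the joint probability in the protocol. \textbf{Theorem.} For every collective attack and any two keys $\mathbf k,\mathbf k'\in\mathbf F_2^m$, $$\langle\Delta_{\rm Eve}(\mathbf k,\mathbf k')\rangle\le 2m\sqrt{P\left[\left(\frac{|\widetilde{\mathbf C}_I|}{n}\ge\frac{d_{r,m}}{2n}\right)\wedge\left(\frac{|\mathbf C_{T_Z}|}{n_z}\le p_{a,z}\right)\wedge\left(\frac{|\mathbf C_{T_X}|}{n_x}\le p_{a,x}\right)\right]}.$$ Here the probability refers to the virtual run with the same attack in which the INFO bits are encoded by Alice and measured by Bob in the $x$ basis, all else being unchanged, and $\widetilde{\mathbf C}_I,\mathbf C_{T_Z},\mathbf C_{T_X}$ are the strings of errors on the INFO, TEST-Z and TEST-X bits in that run. -/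

import Mathlib

open scoped BigOperators

namespace BB84InfoZ

noncomputable section

/-! ## Bit strings and codes -/

/-- Bit strings of length `t`, as vectors over the field with two elements.
The number of `1`-bits of `c` is `hammingNorm c`, the Hamming distance is `hammingDist`. -/
abbrev BitString (t : ℕ) : Type := Fin t → ZMod 2

/-- The positions of the `1`-bits of a string `s` of weight `k`, in increasing order. -/
def positions {N k : ℕ} (s : BitString N) (hs : hammingNorm s = k) : Fin k ↪o Fin N :=
  (Finset.univ.filter fun j => s j ≠ 0).orderEmbOfFin hs

/-- The substring `c_s` of `c` that consists of the bits `c_j` with `s_j = 1`. -/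
def substring {N k : ℕ} (s : BitString N) (hs : hammingNorm s = k) (c : BitString N) :
    BitString k :=
  fun l => c (positions s hs l)

/-- The error rate `|c| / t` of a string of errors `c` of length `t`. -/
def errorRate {t : ℕ} (c : BitString t) : ℝ := (hammingNorm c : ℝ) / (t : ℝ)

/-- The Hamming distance `d_H(w, V)` of a vector from a subspace. -/
def distToSubspace {n : ℕ} (w : BitString n) (V : Submodule (ZMod 2) (BitString n)) : ℕ :=
  sInf {d : ℕ | ∃ u ∈ V, hammingDist w u = d}

/-- The vectors `v_1, …, v_{r+m}` (indexed from `0`): the rows of the parity check matrix `PC`,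
followed by the rows of the privacy amplification matrix `PK`. -/
def codeRows {n r m : ℕ} (PC : Matrix (Fin r) (Fin n) (ZMod 2))
    (PK : Matrix (Fin m) (Fin n) (ZMod 2)) : Fin (r + m) → BitString n :=
  Fin.append PC.row PK.row

/-- `d_{r,m} = min_{r ≤ r' < r+m} d_H(v_{r'+1}, V_{r'})`, with `V_{r'} = Span {v_1, …, v_{r'}}`.
As rows are indexed from `0`, the vector `v_{r'+1}` is the row of index `r'`. -/
def minDist {n r m : ℕ} (PC : Matrix (Fin r) (Fin n) (ZMod 2))
    (PK : Matrix (Fin m) (Fin n) (ZMod 2)) : ℕ :=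
  sInf {d : ℕ | ∃ r' : Fin (r + m), r ≤ (r' : ℕ) ∧
    d = distToSubspace (codeRows PC PK r')
      (Submodule.span (ZMod 2) (codeRows PC PK '' {i | i < r'}))}

/-! ## Partitions into INFO, TEST-Z and TEST-X bits -/

/-- A partition `(s, z, b)` of the `N = n + nz + nx` bits into `n` INFO bits (`s_j = 1`),
`nz` TEST-Z bits (`z_j = 1`) and `nx` TEST-X bits (`b_j = 1`). -/
@[ext]
structure BitPartition (n nz nx : ℕ) where
  s : BitString (n + nz + nx)
  z : BitString (n + nz + nx)
  b : BitString (n + nz + nx)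
  weight_s : hammingNorm s = n
  weight_z : hammingNorm z = nz
  weight_b : hammingNorm b = nx
  weight_add : hammingNorm (s + z + b) = n + nz + nx

instance (n nz nx : ℕ) : Fintype (BitPartition n nz nx) :=
  Fintype.ofInjective
    (fun P : BitPartition n nz nx => (P.s, P.z, P.b))
    (fun P Q h => by
      simp only [Prod.mk.injEq] at h
      exact BitPartition.ext h.1 h.2.1 h.2.2)

namespace BitPartition

variable {n nz nx : ℕ} (P : BitPartition n nz nx)

/-- The substring of the INFO bits. -/
def info (c : BitString (n + nz + nx)) : BitString n := substring P.s P.weight_s c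

/-- The substring of the TEST-Z bits. -/
def testZ (c : BitString (n + nz + nx)) : BitString nz := substring P.z P.weight_z c

/-- The substring of the TEST-X bits. -/
def testX (c : BitString (n + nz + nx)) : BitString nx := substring P.b P.weight_b c

/-- The position, among all the bits, of the `l`-th INFO bit. -/
def infoPos (l : Fin n) : Fin (n + nz + nx) := positions P.s P.weight_s l

/-- The bases in which the qubits are encoded and measured in the protocol: the `x` basis (`1`)
for the TEST-X bits, the `z` basis (`0`) for all the other bits. -/
def realBases : BitString (n + nz + nx) := P.b

/-- The bases in the virtual run in which the INFO bits, too, are encoded and measured in the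
`x` basis. -/
def virtualBases : BitString (n + nz + nx) := P.b + P.s

end BitPartition

/-! ## Qubits and collective attacks -/

/-- The qubit state `|a^β⟩`: for `β = 0` the computational (`z`) basis, for `β = 1` the `x` basis
`|0^1⟩ = (|0⟩ + |1⟩)/√2`, `|1^1⟩ = (|0⟩ - |1⟩)/√2`. -/
def ket (β a : ZMod 2) : ZMod 2 → ℂ := fun t =>
  if β = 0 then (if t = a then 1 else 0)
  else (if t = 1 ∧ a = 1 then -1 else 1) / (Real.sqrt 2 : ℂ)

/-- A collective attack on `N` qubits: for every `j`, a finite-dimensional probe space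
(with an orthonormal basis indexed by `Fin (dim j)`), a normalized initial probe state `|0^E⟩`,
and a unitary operator on the compound system of the `j`-th probe and the `j`-th qubit. -/
structure CollectiveAttack (N : ℕ) where
  dim : Fin N → ℕ
  init : ∀ j, Fin (dim j) → ℂ
  init_normalized : ∀ j, ∑ e, ‖init j e‖ ^ 2 = 1
  U : ∀ j, Matrix.unitaryGroup (Fin (dim j) × ZMod 2) ℂ

namespace CollectiveAttack

variable {N : ℕ} (A : CollectiveAttack N)

/-- The joint state `U_j |0^E⟩ |a^β⟩` of the `j`-th probe and the `j`-th qubit, after the attack,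
if Alice sends `|a^β⟩`. -/
def evolved (j : Fin N) (β a : ZMod 2) : Fin (A.dim j) × ZMod 2 → ℂ :=
  (A.U j : Matrix (Fin (A.dim j) × ZMod 2) (Fin (A.dim j) × ZMod 2) ℂ).mulVec
    (fun p => A.init j p.1 * ket β a p.2)

/-- The (non-normalized) state `(1 ⊗ ⟨y^β|) U_j |0^E⟩ |a^β⟩` of the `j`-th probe: the vector
`E^β_{a y}` of the expansion of `U_j |0^E⟩ |a^β⟩` in the basis `|0^β⟩, |1^β⟩` of the qubit. -/
def probeVec (j : Fin N) (β a y : ZMod 2) : Fin (A.dim j) → ℂ :=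
  fun e => ∑ t, star (ket β y t) * A.evolved j β a (e, t)

/-- The probability that Bob, measuring the `j`-th qubit in the basis `β`, gets the bit `y`,
if Alice sends `|a^β⟩` (Born rule). -/
def bobProb (j : Fin N) (β a y : ZMod 2) : ℝ := ∑ e, ‖A.probeVec j β a y e‖ ^ 2

/-- The density matrix of the `j`-th probe after the attack, if Alice sends `|a^β⟩`: the partial
trace of the joint state over the qubit. -/
def probeState (j : Fin N) (β a : ZMod 2) : Matrix (Fin (A.dim j)) (Fin (A.dim j)) ℂ :=
  fun e e' => ∑ t, A.evolved j β a (e, t) * star (A.evolved j β a (e', t))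

end CollectiveAttack

/-! ## Eve's states -/

open scoped MatrixOrder in
/-- The trace distance `(1/2) tr |ρ - σ|`, where `|X| = √(Xᴴ X)`. -/
def traceDist {ι : Type*} [Fintype ι] [DecidableEq ι] (ρ σ : Matrix ι ι ℂ) : ℝ :=
  (1 / 2) * (Matrix.trace (CFC.abs (ρ - σ))).re

section Eve

variable {n nz nx r m : ℕ}

/-- The index set of an orthonormal basis of the tensor product of the probe spaces attached to the
INFO qubits. -/
abbrev EveIndex (A : CollectiveAttack (n + nz + nx)) (P : BitPartition n nz nx) : Type :=
  ∀ l : Fin n, Fin (A.dim (P.infoPos l))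

/-- Eve's state `ρ_x^{b'}`, the tensor product of her probe states on the INFO bits, given that
Alice sent the INFO bit string `x` encoded in the bases `b' = b_s` of the protocol. -/
def eveState (A : CollectiveAttack (n + nz + nx)) (P : BitPartition n nz nx) (x : BitString n) :
    Matrix (EveIndex A P) (EveIndex A P) ℂ :=
  fun f g => ∏ l, A.probeState (P.infoPos l) (P.info P.realBases l) (x l) (f l) (g l)

/-- Eve's state corresponding to the final key `k`, given that she knows the syndrome `ξ`:
the average of `ρ_x^{b'}` over the `2^(n-r-m)` strings `x` with syndrome `ξ` and key `k`. -/
def eveKeyState (A : CollectiveAttack (n + nz + nx)) (P : BitPartition n nz nx)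
    (PC : Matrix (Fin r) (Fin n) (ZMod 2)) (PK : Matrix (Fin m) (Fin n) (ZMod 2))
    (ξ : BitString r) (k : BitString m) : Matrix (EveIndex A P) (EveIndex A P) ℂ :=
  ((2 : ℂ) ^ (n - r - m))⁻¹ •
    ∑ x ∈ Finset.univ.filter (fun x : BitString n => PC.mulVec x = ξ ∧ PK.mulVec x = k),
      eveState A P x

/-- The random variable `Δ_Eve(k, k' | P, ξ, c_z, c_b)`: the trace distance between Eve's states for
the keys `k` and `k'` if the test is passed, and `0` if it fails. -/
def deltaEve (A : CollectiveAttack (n + nz + nx))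
    (PC : Matrix (Fin r) (Fin n) (ZMod 2)) (PK : Matrix (Fin m) (Fin n) (ZMod 2))
    (paz pax : ℝ) (k k' : BitString m)
    (P : BitPartition n nz nx) (ξ : BitString r) (cz : BitString nz) (cb : BitString nx) : ℝ :=
  open Classical in
  if errorRate cz ≤ paz ∧ errorRate cb ≤ pax then
    traceDist (eveKeyState A P PC PK ξ k) (eveKeyState A P PC PK ξ k')
  else 0

/-! ## Probabilities -/

/-- The probability of the elementary event that the partition `P` is chosen, Alice sends the
bits `i` and Bob measures the bits `iB`, if the qubits are encoded and measured in the bases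
`bases P`. The partition and the string `i` are independent and uniformly distributed, and
the qubits are attacked one by one. -/
def outcomeProb (A : CollectiveAttack (n + nz + nx))
    (bases : BitPartition n nz nx → BitString (n + nz + nx))
    (P : BitPartition n nz nx) (i iB : BitString (n + nz + nx)) : ℝ :=
  (Fintype.card (BitPartition n nz nx) : ℝ)⁻¹ * ((2 : ℝ) ^ (n + nz + nx))⁻¹ *
    ∏ j, A.bobProb j (bases P j) (i j) (iB j)

/-- The probability of an event that concerns the partition, Alice's bits and Bob's bits. -/
def eventProb (A : CollectiveAttack (n + nz + nx))
    (bases : BitPartition n nz nx → BitString (n + nz + nx))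
    (E : BitPartition n nz nx → BitString (n + nz + nx) → BitString (n + nz + nx) → Prop) : ℝ :=
  open Classical in
  ∑ P, ∑ i, ∑ iB, if E P i iB then outcomeProb A bases P i iB else 0

/-- The expected value `⟨Δ_Eve(k, k')⟩`: the sum of `Δ_Eve(k, k' | P, ξ, c_z, c_b)` times
`p(P, ξ, c_z, c_b)` over the partitions `P`, the syndromes `ξ` of the INFO string `x = i_s`, and
the error strings `c_z`, `c_b` (with `c = i + iB`) on the TEST-Z and TEST-X bits. -/
def expectedDeltaEve (A : CollectiveAttack (n + nz + nx))
    (PC : Matrix (Fin r) (Fin n) (ZMod 2)) (PK : Matrix (Fin m) (Fin n) (ZMod 2))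
    (paz pax : ℝ) (k k' : BitString m) : ℝ :=
  ∑ P : BitPartition n nz nx, ∑ ξ : BitString r, ∑ cz : BitString nz, ∑ cb : BitString nx,
    deltaEve A PC PK paz pax k k' P ξ cz cb *
      eventProb A BitPartition.realBases (fun Q i iB =>
        Q = P ∧ PC.mulVec (Q.info i) = ξ ∧ Q.testZ (i + iB) = cz ∧ Q.testX (i + iB) = cb)

end Eve

end

end BB84InfoZ

namespace BB84InfoZ

noncomputable section

/-! ## Signs -/

/-- The character `a ↦ (-1)^a` of the field with two elements. -/
def bitSign (a : ZMod 2) : ℂ := if a = 0 then 1 else -1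

@[simp] lemma bitSign_zero : bitSign 0 = 1 := by simp [bitSign]

@[simp] lemma bitSign_one : bitSign 1 = -1 := by simp [bitSign]

lemma sum_zmod_two {M : Type*} [AddCommMonoid M] (f : ZMod 2 → M) : ∑ a, f a = f 0 + f 1 :=
  Fin.sum_univ_two f

lemma zmod_two_cases (a : ZMod 2) : a = 0 ∨ a = 1 := by
  revert a; decide

lemma bitSign_add (a b : ZMod 2) : bitSign (a + b) = bitSign a * bitSign b := by
  have h : (1 + 1 : ZMod 2) = 0 := by decide
  rcases zmod_two_cases a with rfl | rfl <;> rcases zmod_two_cases b with rfl | rfl <;> simp [h]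

@[simp] lemma bitSign_mul_self (a : ZMod 2) : bitSign a * bitSign a = 1 := by
  rcases zmod_two_cases a with rfl | rfl <;> simp

@[simp] lemma star_bitSign (a : ZMod 2) : star (bitSign a) = bitSign a := by
  rcases zmod_two_cases a with rfl | rfl <;> simp

@[simp] lemma norm_bitSign (a : ZMod 2) : ‖bitSign a‖ = 1 := by
  rcases zmod_two_cases a with rfl | rfl <;> simp

lemma bitSign_sum {ι : Type*} (s : Finset ι) (f : ι → ZMod 2) :
    bitSign (∑ i ∈ s, f i) = ∏ i ∈ s, bitSign (f i) := by
  classical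
  induction s using Finset.induction_on with
  | empty => simp
  | insert i s hi ih => rw [Finset.sum_insert hi, Finset.prod_insert hi, bitSign_add, ih]

lemma sum_bitSign_mul (a : ZMod 2) : ∑ b, bitSign (b * a) = if a = 0 then 2 else 0 := by
  rw [sum_zmod_two]
  rcases zmod_two_cases a with rfl | rfl <;> norm_num

lemma bits_add_self {ι : Type*} (a : ι → ZMod 2) : a + a = 0 :=
  funext fun _ => CharTwo.add_self_eq_zero _

lemma bits_add_add_cancel {ι : Type*} (a b : ι → ZMod 2) : a + b + b = a := by
  rw [add_assoc, bits_add_self, add_zero]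

lemma bits_add_eq_zero_iff {ι : Type*} (a b : ι → ZMod 2) : a + b = 0 ↔ a = b := by
  constructor
  · intro h
    rw [← bits_add_add_cancel a b, h, zero_add]
  · rintro rfl
    exact bits_add_self a

/-! ### Fourier analysis of matrix-valued functions on bit strings -/

section Fourier

variable {ι : Type*} [Fintype ι] [DecidableEq ι]

lemma sum_bitSign_dotProduct (d : ι → ZMod 2) :
    ∑ x : ι → ZMod 2, bitSign (x ⬝ᵥ d) = if d = 0 then 2 ^ Fintype.card ι else 0 := by
  simp only [dotProduct, bitSign_sum]
  rw [← Fintype.piFinset_univ, ← Finset.prod_univ_sum (fun _ : ι => Finset.univ)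
    (fun i b => bitSign (b * d i))]
  simp only [sum_bitSign_mul]
  split_ifs with h
  · simp [h, Finset.card_univ]
  · obtain ⟨i, hi⟩ := Function.ne_iff.mp h
    exact Finset.prod_eq_zero (Finset.mem_univ i) (if_neg hi)


/-- A Plancherel identity with a shift: the double expansion carries the character of d + v + d',
and the sum over x kills every pair except d' = d + v. -/
lemma sum_bitSign_smul_mul_conjTranspose {α β : Type*} [Fintype β]
    (Y : (ι → ZMod 2) → Matrix α β ℂ) (v : ι → ZMod 2) :
    ∑ x : ι → ZMod 2, bitSign (x ⬝ᵥ v) •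
        ((∑ d, bitSign (x ⬝ᵥ d) • Y d) * (∑ d, bitSign (x ⬝ᵥ d) • Y d).conjTranspose) =
      (2 : ℂ) ^ Fintype.card ι • ∑ d, Y d * (Y (d + v)).conjTranspose := by
  have h : ∀ x : ι → ZMod 2, bitSign (x ⬝ᵥ v) •
        ((∑ d, bitSign (x ⬝ᵥ d) • Y d) * (∑ d, bitSign (x ⬝ᵥ d) • Y d).conjTranspose) =
      ∑ d, ∑ d', bitSign (x ⬝ᵥ (d + v + d')) • (Y d * (Y d').conjTranspose) := by
    intro x
    rw [Matrix.conjTranspose_sum, Matrix.sum_mul, Finset.smul_sum]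
    refine Finset.sum_congr rfl fun d _ => ?_
    rw [Matrix.mul_sum, Finset.smul_sum]
    refine Finset.sum_congr rfl fun d' _ => ?_
    rw [Matrix.conjTranspose_smul, star_bitSign, Matrix.smul_mul, Matrix.mul_smul, smul_smul,
      smul_smul, dotProduct_add, dotProduct_add, bitSign_add, bitSign_add]
    congr 1
    ring
  simp only [h]
  rw [Finset.sum_comm, Finset.smul_sum]
  refine Finset.sum_congr rfl fun d _ => ?_
  rw [Finset.sum_comm, Finset.sum_eq_single (d + v)]
  · rw [← Finset.sum_smul, sum_bitSign_dotProduct, if_pos (bits_add_self _)]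
  · intro d' _ hd'
    rw [← Finset.sum_smul, sum_bitSign_dotProduct, if_neg, zero_smul]
    rw [bits_add_eq_zero_iff]
    exact fun h => hd' h.symm
  · simp

/-- Signed summation over translates is Fourier dual to restriction to an affine subspace:
translating d back leaves a character sum over t, which vanishes unless x satisfies all the
parities. A constrained sum over x thus becomes a full one. -/
lemma sum_bitSign_combination {κ : Type*} [Fintype κ] [DecidableEq κ] {M : Type*} [AddCommGroup M]
    [Module ℂ M] (H : (ι → ZMod 2) → M) (R : κ → ι → ZMod 2) (w : κ → ZMod 2) (x : ι → ZMod 2) :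
    ∑ d, bitSign (x ⬝ᵥ d) • ∑ t : κ → ZMod 2, bitSign (t ⬝ᵥ w) • H (d + ∑ i, t i • R i) =
      if ∀ i, R i ⬝ᵥ x = w i then
        (2 : ℂ) ^ Fintype.card κ • ∑ d, bitSign (x ⬝ᵥ d) • H d else 0 := by
  have h : ∀ t : κ → ZMod 2,
      ∑ d, bitSign (x ⬝ᵥ d) • bitSign (t ⬝ᵥ w) • H (d + ∑ i, t i • R i) =
        bitSign (t ⬝ᵥ (fun i => R i ⬝ᵥ x + w i)) • ∑ d, bitSign (x ⬝ᵥ d) • H d := by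
    intro t
    rw [Finset.smul_sum, ← Equiv.sum_comp (Equiv.addRight (∑ i, t i • R i))]
    refine Finset.sum_congr rfl fun d _ => ?_
    simp only [Equiv.coe_addRight]
    rw [bits_add_add_cancel, smul_smul, smul_smul, dotProduct_add,
      bitSign_add]
    have : t ⬝ᵥ (fun i => R i ⬝ᵥ x + w i) = x ⬝ᵥ (∑ i, t i • R i) + t ⬝ᵥ w := by
      rw [show (fun i => R i ⬝ᵥ x + w i) = (fun i => R i ⬝ᵥ x) + w from rfl, dotProduct_add,
        dotProduct_sum]
      congr 1
      simp only [dotProduct_smul, smul_eq_mul]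
      exact Finset.sum_congr rfl fun i _ => by rw [dotProduct_comm x]
    rw [this, bitSign_add]
    congr 1
    ring
  simp only [Finset.smul_sum]
  rw [Finset.sum_comm]
  simp only [h]
  rw [← Finset.sum_smul, sum_bitSign_dotProduct]
  have hiff : (fun i => R i ⬝ᵥ x + w i) = 0 ↔ ∀ i, R i ⬝ᵥ x = w i := by
    rw [show (fun i => R i ⬝ᵥ x + w i) = (fun i => R i ⬝ᵥ x) + w from rfl, bits_add_eq_zero_iff,
      funext_iff]
  simp only [hiff]
  split_ifs
  · rw [Finset.smul_sum]
  · rw [zero_smul]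

end Fourier

/-! ## The trace distance as a supremum over unitary matrices -/

section Trace

variable {α β : Type*} [Fintype α] [Fintype β]

open scoped MatrixOrder in
lemma exists_unitary_mul_eq_abs [DecidableEq α] {X : Matrix α α ℂ} (hX : X.IsHermitian) :
    ∃ S : Matrix α α ℂ, S.conjTranspose * S = 1 ∧ S * X = CFC.abs X := by
  have hX' : IsSelfAdjoint X := hX
  have hfin : (spectrum ℝ X).Finite := Matrix.finite_real_spectrum
  have hc : ∀ f : ℝ → ℝ, ContinuousOn f (spectrum ℝ X) := fun f => hfin.continuousOn f
  -- The value at 0 must be 1, not 0: then s² = 1 everywhere and the sign of X is unitary even if X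
  -- is singular.
  let s : ℝ → ℝ := fun t => if 0 ≤ t then 1 else -1
  refine ⟨cfc s X, ?_, ?_⟩
  · have h1 : (cfc s X).conjTranspose = cfc s X := cfc_predicate s X
    rw [h1, ← cfc_mul s s X (hc _) (hc _), ← cfc_one ℝ X]
    congr 1
    funext t
    simp only [s]
    split_ifs <;> norm_num
  · rw [CFC.abs_eq_cfc_norm X hX']
    nth_rewrite 2 [← cfc_id' ℝ X]
    rw [← cfc_mul s _ X (hc _) (hc _)]
    congr 1
    funext t
    simp only [s]
    split_ifs with h
    · rw [one_mul, Real.norm_of_nonneg h]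
    · rw [neg_one_mul, Real.norm_of_nonpos (not_le.mp h).le]

/-- Only the S with S(ρ - σ) = |ρ - σ| matters, but once S is fixed the trace is linear in ρ - σ, so
the difference can be split into pieces estimated separately. -/
lemma traceDist_le_of_unitary [DecidableEq α] {ρ σ : Matrix α α ℂ} (hρ : ρ.IsHermitian)
    (hσ : σ.IsHermitian) {K : ℝ}
    (h : ∀ S : Matrix α α ℂ, S.conjTranspose * S = 1 → ‖(S * (ρ - σ)).trace‖ ≤ 2 * K) :
    traceDist ρ σ ≤ K := by
  obtain ⟨S, hS, hSX⟩ := exists_unitary_mul_eq_abs (hρ.sub hσ)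
  have h1 := (Complex.re_le_norm _).trans (h S hS)
  rw [hSX] at h1
  unfold traceDist
  linarith

/-- The square of the Hilbert–Schmidt norm. -/
def normSq (A : Matrix α β ℂ) : ℝ := ∑ i, ∑ j, ‖A i j‖ ^ 2

lemma normSq_nonneg (A : Matrix α β ℂ) : 0 ≤ normSq A := by
  unfold normSq; positivity

lemma trace_mul_conjTranspose_self (A : Matrix α β ℂ) :
    (A * A.conjTranspose).trace = (normSq A : ℂ) := by
  simp only [Matrix.trace, Matrix.diag, Matrix.mul_apply, Matrix.conjTranspose_apply, normSq,
    Complex.ofReal_sum]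
  refine Finset.sum_congr rfl fun i _ => Finset.sum_congr rfl fun j _ => ?_
  rw [RCLike.star_def, Complex.mul_conj, Complex.normSq_eq_norm_sq]

lemma normSq_unitary_mul [DecidableEq α] {S : Matrix α α ℂ} (hS : S.conjTranspose * S = 1)
    (A : Matrix α β ℂ) : normSq (S * A) = normSq A := by
  have h : ((normSq (S * A) : ℝ) : ℂ) = (normSq A : ℝ) := by
    rw [← trace_mul_conjTranspose_self, ← trace_mul_conjTranspose_self,
      Matrix.conjTranspose_mul, Matrix.trace_mul_comm, Matrix.mul_assoc, ← Matrix.mul_assoc _ S A,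
      hS, Matrix.one_mul, Matrix.trace_mul_comm]
  exact_mod_cast h

lemma norm_trace_mul_conjTranspose_le (A B : Matrix α β ℂ) :
    ‖(A * B.conjTranspose).trace‖ ≤ Real.sqrt (normSq A) * Real.sqrt (normSq B) := by
  have h1 : ‖(A * B.conjTranspose).trace‖ ≤ ∑ p : α × β, ‖A p.1 p.2‖ * ‖B p.1 p.2‖ := by
    rw [Fintype.sum_prod_type]
    simp only [Matrix.trace, Matrix.diag, Matrix.mul_apply, Matrix.conjTranspose_apply]
    refine (norm_sum_le _ _).trans (Finset.sum_le_sum fun i _ => ?_)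
    refine (norm_sum_le _ _).trans (Finset.sum_le_sum fun j _ => ?_)
    rw [norm_mul, norm_star]
  refine h1.trans ((Real.sum_mul_le_sqrt_mul_sqrt _ _ _).trans ?_)
  rw [Fintype.sum_prod_type, Fintype.sum_prod_type]
  rfl

lemma norm_trace_unitary_mul_le [DecidableEq α] {S : Matrix α α ℂ} (hS : S.conjTranspose * S = 1)
    (A B : Matrix α β ℂ) :
    ‖(S * (A * B.conjTranspose)).trace‖ ≤ Real.sqrt (normSq A) * Real.sqrt (normSq B) := by
  rw [← Matrix.mul_assoc, ← normSq_unitary_mul hS A]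
  exact norm_trace_mul_conjTranspose_le _ _

/-- Pythagoras: the cross terms vanish and the unimodular coefficients drop out. -/
lemma normSq_sum_smul {τ : Type*} [Fintype τ] (c : τ → ℂ) (hc : ∀ t, ‖c t‖ = 1)
    (A : τ → Matrix α β ℂ)
    (hA : ∀ t t', t ≠ t' → (A t * (A t').conjTranspose).trace = 0) :
    normSq (∑ t, c t • A t) = ∑ t, normSq (A t) := by
  have h : ((normSq (∑ t, c t • A t) : ℝ) : ℂ) = ((∑ t, normSq (A t) : ℝ) : ℂ) := by
    rw [← trace_mul_conjTranspose_self, Matrix.conjTranspose_sum, Matrix.sum_mul,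
      Matrix.trace_sum, Complex.ofReal_sum]
    refine Finset.sum_congr rfl fun t _ => ?_
    rw [Matrix.mul_sum, Matrix.trace_sum, Finset.sum_eq_single t]
    · rw [Matrix.conjTranspose_smul, Matrix.smul_mul, Matrix.mul_smul, smul_smul,
        Matrix.trace_smul, trace_mul_conjTranspose_self, RCLike.star_def, Complex.mul_conj,
        Complex.normSq_eq_norm_sq, hc]
      simp
    · intro t' _ ht
      rw [Matrix.conjTranspose_smul, Matrix.smul_mul, Matrix.mul_smul, smul_smul,
        Matrix.trace_smul, hA t t' ht.symm, smul_zero]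
    · simp
  exact_mod_cast h

end Trace

/-! ## The contribution of one key bit -/

section OneBit

variable {α β : Type*} [Fintype α] [DecidableEq α] [Fintype β] {n : ℕ}
  {κ : Type*} [Fintype κ] [DecidableEq κ]

lemma hammingDist_eq_hammingNorm_add (a b : BitString n) :
    hammingDist a b = hammingNorm (a + b) := by
  rw [hammingDist_eq_hammingNorm, neg_eq_of_add_eq_zero_left (bits_add_self a)]

/-- Each product is charged to a factor at which p holds. The involution d ↦ d + v exchanges the two
kinds of charge, whence the factor 2; Cauchy–Schwarz does the rest. -/
lemma sum_mul_shift_le {y : BitString n → ℝ} (hy : ∀ d, 0 ≤ y d) (v : BitString n)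
    (p : BitString n → Prop) [DecidablePred p] (hp : ∀ d, p d ∨ p (d + v)) :
    ∑ d, y d * y (d + v) ≤
      2 * (Real.sqrt (∑ d, if p d then y d ^ 2 else 0) * Real.sqrt (∑ d, y d ^ 2)) := by
  have h1 : ∀ d, y d * y (d + v) ≤
      (if p d then y d else 0) * y (d + v) + (if p (d + v) then y (d + v) else 0) * y d := by
    intro d
    have h0 := mul_nonneg (hy d) (hy (d + v))
    rcases hp d with h | h
    · rw [if_pos h]
      refine le_add_of_nonneg_right (mul_nonneg ?_ (hy d))
      split_ifs
      exacts [hy _, le_rfl]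
    · rw [if_pos h, mul_comm (y (d + v))]
      refine le_add_of_nonneg_left (mul_nonneg ?_ (hy _))
      split_ifs
      exacts [hy _, le_rfl]
  have h2 : ∑ d, (if p (d + v) then y (d + v) else 0) * y d =
      ∑ d, (if p d then y d else 0) * y (d + v) := by
    rw [← Equiv.sum_comp (Equiv.addRight v)]
    simp only [Equiv.coe_addRight, bits_add_add_cancel]
  have h3 : ∑ d, y (d + v) ^ 2 = ∑ d, y d ^ 2 :=
    Equiv.sum_comp (Equiv.addRight v) (fun d => y d ^ 2)
  calc ∑ d, y d * y (d + v) ≤ 2 * ∑ d, (if p d then y d else 0) * y (d + v) := by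
        refine (Finset.sum_le_sum fun d _ => h1 d).trans_eq ?_
        rw [Finset.sum_add_distrib, h2, two_mul]
    _ ≤ _ := by
        refine mul_le_mul_of_nonneg_left ?_ zero_le_two
        refine (Real.sum_mul_le_sqrt_mul_sqrt _ _ _).trans_eq ?_
        rw [h3]
        simp only [ite_pow, ne_eq, OfNat.ofNat_ne_zero, not_false_eq_true, zero_pow]

/-- The weight of the errors of at least `D / 2` bits. -/
def tailWeight (q : BitString n → ℝ) (D : ℕ) : ℝ :=
  ∑ d, if D ≤ 2 * hammingNorm d then q d else 0

/-- The effect of a single key bit: the rows R are those already imposed, v is the new one, and D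
bounds the distance of v from their span. -/
lemma norm_trace_signed_sum_le
    (H : BitString n → Matrix α β ℂ)
    (horth : ∀ d d', d ≠ d' → (H d * (H d').conjTranspose).trace = 0)
    (hone : ∑ d, normSq (H d) = 1)
    {R : κ → BitString n} (hR : LinearIndependent (ZMod 2) R) (v : BitString n) (D : ℕ)
    (hD : ∀ t : κ → ZMod 2, D ≤ hammingNorm (v + ∑ i, t i • R i)) (w : κ → ZMod 2)
    {S : Matrix α α ℂ} (hS : S.conjTranspose * S = 1) :
    ‖(S * ((2 : ℂ) ^ Fintype.card κ * ((2 : ℂ) ^ n)⁻¹) •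
      ∑ x : BitString n, if ∀ i, R i ⬝ᵥ x = w i then
        bitSign (x ⬝ᵥ v) • ((∑ d, bitSign (x ⬝ᵥ d) • H d) *
          (∑ d, bitSign (x ⬝ᵥ d) • H d).conjTranspose) else 0).trace‖ ≤
      2 * Real.sqrt (tailWeight (fun d => normSq (H d)) D) := by
  classical
  set T : (κ → ZMod 2) → BitString n := fun t => ∑ i, t i • R i with hT
  have hTadd : ∀ t t', T (t + t') = T t + T t' := by
    intro t t'
    simp only [hT, Pi.add_apply, add_smul, Finset.sum_add_distrib]
  -- Independence of the rows makes the strings d + T t distinct, so that orthogonality of the H's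
  -- gives Pythagoras for each Y d.
  have hTinj : Function.Injective T := fun t t' h => by
    have h0 : T (t + t') = 0 := by rw [hTadd, h, bits_add_self]
    rw [← bits_add_eq_zero_iff]
    exact funext (Fintype.linearIndependent_iff.mp hR _ h0)
  let Y : BitString n → Matrix α β ℂ := fun d => ∑ t : κ → ZMod 2, bitSign (t ⬝ᵥ w) • H (d + T t)
  have hY : ∀ d, normSq (Y d) = ∑ t, normSq (H (d + T t)) := fun d =>
    normSq_sum_smul _ (fun _ => norm_bitSign _) _ fun t t' ht => horth _ _ fun h =>
      ht (hTinj (add_left_cancel h))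
  have hfour := sum_bitSign_smul_mul_conjTranspose Y v
  simp only [Y, hT, sum_bitSign_combination] at hfour
  have hiff : ∀ x : BitString n,
      bitSign (x ⬝ᵥ v) • (((if ∀ i, R i ⬝ᵥ x = w i then
        (2 : ℂ) ^ Fintype.card κ • ∑ d, bitSign (x ⬝ᵥ d) • H d else 0)) *
        (if ∀ i, R i ⬝ᵥ x = w i then
        (2 : ℂ) ^ Fintype.card κ • ∑ d, bitSign (x ⬝ᵥ d) • H d else 0).conjTranspose) =
      ((2 : ℂ) ^ Fintype.card κ * (2 : ℂ) ^ Fintype.card κ) • (if ∀ i, R i ⬝ᵥ x = w i then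
        bitSign (x ⬝ᵥ v) • ((∑ d, bitSign (x ⬝ᵥ d) • H d) *
          (∑ d, bitSign (x ⬝ᵥ d) • H d).conjTranspose) else 0) := by
    intro x
    split_ifs
    · rw [Matrix.conjTranspose_smul, Matrix.smul_mul, Matrix.mul_smul, smul_smul, smul_smul,
        smul_smul]
      congr 1
      simp only [star_pow, star_ofNat]
      ring
    · simp
  simp only [hiff] at hfour
  rw [← Finset.smul_sum, Fintype.card_fin] at hfour
  set X := ∑ x : BitString n, if ∀ i, R i ⬝ᵥ x = w i then
        bitSign (x ⬝ᵥ v) • ((∑ d, bitSign (x ⬝ᵥ d) • H d) *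
          (∑ d, bitSign (x ⬝ᵥ d) • H d).conjTranspose) else 0 with hX
  have hXY : ((2 : ℂ) ^ Fintype.card κ * ((2 : ℂ) ^ n)⁻¹) • X =
      ((2 : ℂ) ^ Fintype.card κ)⁻¹ • ∑ d, Y d * (Y (d + v)).conjTranspose := by
    have h3 := congrArg
      (fun Z => (((2 : ℂ) ^ Fintype.card κ)⁻¹ * ((2 : ℂ) ^ n)⁻¹) • Z) hfour
    simp only [smul_smul] at h3
    convert h3 using 2
    · field_simp
    · field_simp
  rw [hXY, Matrix.mul_smul, Matrix.trace_smul, norm_smul, norm_inv, norm_pow, Complex.norm_ofNat,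
    inv_mul_le_iff₀ (by positivity), Matrix.mul_sum, Matrix.trace_sum]
  -- Light elements of both cosets would add up to an element of v + span R of weight less than D,
  -- by the triangle inequality.
  have hheavy : ∀ d, (∀ t, D ≤ 2 * hammingNorm (d + T t)) ∨
      (∀ t, D ≤ 2 * hammingNorm (d + v + T t)) := by
    intro d
    by_contra! hcon
    obtain ⟨⟨t, ht⟩, t', ht'⟩ := hcon
    have h4 := hD (t + t')
    rw [show ∑ i, (t + t') i • R i = T (t + t') from rfl, hTadd] at h4
    have h5 : v + (T t + T t') = (d + T t) + (d + v + T t') := by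
      have := bits_add_self d
      calc v + (T t + T t') = (d + d) + (v + (T t + T t')) := by rw [this, zero_add]
        _ = _ := by abel
    rw [h5] at h4
    have h6 : hammingNorm ((d + T t) + (d + v + T t')) ≤
        hammingNorm (d + T t) + hammingNorm (d + v + T t') := by
      have := hammingDist_triangle (d + T t) 0 (d + v + T t')
      rwa [hammingDist_zero_right, hammingDist_zero_left, hammingDist_eq_hammingNorm_add] at this
    omega
  -- Every string lies in the coset sums of exactly 2^|κ| indices d; the two roots of this factor
  -- cancel the prefactor 2^{-|κ|}.
  have hsum : ∀ g : BitString n → ℝ, ∑ d, ∑ t, g (d + T t) = 2 ^ Fintype.card κ * ∑ d, g d := by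
    intro g
    rw [Finset.sum_comm]
    have : ∀ t, ∑ d, g (d + T t) = ∑ d, g d := fun t => Equiv.sum_comp (Equiv.addRight (T t)) g
    simp [this]
  have htot : ∑ d, Real.sqrt (normSq (Y d)) ^ 2 = 2 ^ Fintype.card κ := by
    simp only [Real.sq_sqrt (normSq_nonneg _)]
    simp only [hY]
    rw [hsum (fun d => normSq (H d)), hone, mul_one]
  have htail : (∑ d, if ∀ t, D ≤ 2 * hammingNorm (d + T t) then Real.sqrt (normSq (Y d)) ^ 2
      else 0) ≤ 2 ^ Fintype.card κ * tailWeight (fun d => normSq (H d)) D := by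
    rw [tailWeight, ← hsum]
    refine Finset.sum_le_sum fun d _ => ?_
    have hnn : ∀ t, (0 : ℝ) ≤ if D ≤ 2 * hammingNorm (d + T t) then normSq (H (d + T t)) else 0 := by
      intro t
      split_ifs
      exacts [normSq_nonneg _, le_rfl]
    split_ifs with h
    · rw [Real.sq_sqrt (normSq_nonneg _), hY]
      exact (Finset.sum_congr rfl fun t _ => (if_pos (h t)).symm).le
    · exact Finset.sum_nonneg fun t _ => hnn t
  calc ‖∑ d, (S * (Y d * (Y (d + v)).conjTranspose)).trace‖
      ≤ ∑ d, Real.sqrt (normSq (Y d)) * Real.sqrt (normSq (Y (d + v))) :=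
        (norm_sum_le _ _).trans (Finset.sum_le_sum fun d _ => norm_trace_unitary_mul_le hS _ _)
    _ ≤ _ := sum_mul_shift_le (y := fun d => Real.sqrt (normSq (Y d)))
        (fun _ => Real.sqrt_nonneg _) v _ hheavy
    _ ≤ 2 * (Real.sqrt (2 ^ Fintype.card κ * tailWeight (fun d => normSq (H d)) D) *
          Real.sqrt (2 ^ Fintype.card κ)) := by
        rw [htot]
        gcongr
    _ = _ := by
        rw [Real.sqrt_mul (by positivity)]
        have := Real.mul_self_sqrt (show (0 : ℝ) ≤ 2 ^ Fintype.card κ by positivity)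
        linear_combination (2 * Real.sqrt (tailWeight (fun d => normSq (H d)) D)) * this

end OneBit

/-! ## The trace distance between the states of two keys -/

section Prefix

variable {α β : Type*} {n M : ℕ}

/-- The normalized sum of the states of the strings whose parities with the first `j` rows are
prescribed by `w`. -/
def prefixState (ρ : BitString n → Matrix α α ℂ) (V : Fin M → BitString n) (w : Fin M → ZMod 2)
    (j : ℕ) : Matrix α α ℂ :=
  open Classical in
  ((2 : ℂ) ^ j * ((2 : ℂ) ^ n)⁻¹) •
    ∑ x : BitString n, if ∀ i : Fin M, (i : ℕ) < j → V i ⬝ᵥ x = w i then ρ x else 0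

lemma prefixState_congr (ρ : BitString n → Matrix α α ℂ) (V : Fin M → BitString n)
    {w w' : Fin M → ZMod 2} {j : ℕ} (h : ∀ i : Fin M, (i : ℕ) < j → w i = w' i) :
    prefixState ρ V w j = prefixState ρ V w' j := by
  unfold prefixState
  congr 1
  refine Finset.sum_congr rfl fun x _ => ?_
  congr 1
  exact propext (forall_congr' fun i => imp_congr_right fun hi => by rw [h i hi])

lemma bitSign_mul_bitSign_eq (a b : ZMod 2) :
    bitSign a * bitSign b = 2 * (if b = a then 1 else 0) - 1 := by
  rcases zmod_two_cases a with rfl | rfl <;> rcases zmod_two_cases b with rfl | rfl <;> norm_num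

/-- A new parity condition doubles the normalization, and twice its indicator minus 1 is a product
of two signs, one of which depends on x. -/
lemma prefixState_succ_sub (ρ : BitString n → Matrix α α ℂ) (V : Fin M → BitString n)
    (w : Fin M → ZMod 2) (j : Fin M) :
    prefixState ρ V w (j + 1) - prefixState ρ V w j =
      bitSign (w j) • ((2 : ℂ) ^ Fintype.card {i : Fin M // i < j} * ((2 : ℂ) ^ n)⁻¹) •
        ∑ x : BitString n, if ∀ i : {i : Fin M // i < j}, V i ⬝ᵥ x = w i then
          bitSign (x ⬝ᵥ V j) • ρ x else 0 := by
  have hcard : Fintype.card {i : Fin M // i < j} = j := by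
    rw [Fintype.card_subtype, Finset.filter_gt_eq_Iio, Fin.card_Iio]
  rw [hcard]
  unfold prefixState
  rw [pow_succ, mul_comm _ (2 : ℂ), mul_assoc (2 : ℂ), ← smul_smul, smul_comm (2 : ℂ),
    smul_comm (bitSign _), ← smul_sub, Finset.smul_sum, Finset.smul_sum, ← Finset.sum_sub_distrib]
  congr 1
  refine Finset.sum_congr rfl fun x _ => ?_
  have h1 : (∀ i : Fin M, (i : ℕ) < j + 1 → V i ⬝ᵥ x = w i) ↔
      (∀ i : Fin M, (i : ℕ) < j → V i ⬝ᵥ x = w i) ∧ V j ⬝ᵥ x = w j := by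
    constructor
    · exact fun h => ⟨fun i hi => h i (by omega), h j (by omega)⟩
    · rintro ⟨h, hj⟩ i hi
      rcases Nat.lt_succ_iff_lt_or_eq.mp hi with hi | hi
      · exact h i hi
      · rwa [Fin.ext hi]
  have h2 : (∀ i : {i : Fin M // i < j}, V i ⬝ᵥ x = w i) ↔
      ∀ i : Fin M, (i : ℕ) < j → V i ⬝ᵥ x = w i :=
    ⟨fun h i hi => h ⟨i, hi⟩, fun h i => h i.1 i.2⟩
  simp only [h1, h2]
  by_cases h : ∀ i : Fin M, (i : ℕ) < j → V i ⬝ᵥ x = w i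
  · rw [if_pos h, if_pos h, smul_smul, dotProduct_comm x, bitSign_mul_bitSign_eq, sub_smul,
      one_smul]
    by_cases hj : V j ⬝ᵥ x = w j
    · rw [if_pos ⟨h, hj⟩, if_pos hj, mul_one]
    · rw [if_neg (fun h' => hj h'.2), if_neg hj, mul_zero, smul_zero, zero_smul]
  · rw [if_neg (fun h' => h h'.1), if_neg h, if_neg h, smul_zero, smul_zero, sub_zero]

/-- Telescoping over k successive parities, each costing one application of the single-bit bound. -/
lemma norm_trace_prefixState_sub_le [Fintype α] [DecidableEq α] [Fintype β]
    (H : BitString n → Matrix α β ℂ)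
    (horth : ∀ d d', d ≠ d' → (H d * (H d').conjTranspose).trace = 0)
    (hone : ∑ d, normSq (H d) = 1) {ρ : BitString n → Matrix α α ℂ}
    (hρ : ∀ x, ρ x = (∑ d, bitSign (x ⬝ᵥ d) • H d) *
      (∑ d, bitSign (x ⬝ᵥ d) • H d).conjTranspose)
    {V : Fin M → BitString n} (hV : LinearIndependent (ZMod 2) V) (w : Fin M → ZMod 2)
    {D r : ℕ} (hD : ∀ j : Fin M, r ≤ (j : ℕ) → ∀ t : {i : Fin M // i < j} → ZMod 2,
      D ≤ hammingNorm (V j + ∑ i, t i • V i))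
    {S : Matrix α α ℂ} (hS : S.conjTranspose * S = 1) (k : ℕ) (hk : r + k ≤ M) :
    ‖(S * (prefixState ρ V w (r + k) - prefixState ρ V w r)).trace‖ ≤
      k * (2 * Real.sqrt (tailWeight (fun d => normSq (H d)) D)) := by
  induction k with
  | zero => simp
  | succ k ih =>
    have h1 : ‖(S * (prefixState ρ V w (r + k + 1) - prefixState ρ V w (r + k))).trace‖ ≤
        2 * Real.sqrt (tailWeight (fun d => normSq (H d)) D) := by
      rw [prefixState_succ_sub ρ V w ⟨r + k, by omega⟩, Matrix.mul_smul, Matrix.trace_smul,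
        norm_smul, norm_bitSign, one_mul]
      simp only [hρ]
      exact norm_trace_signed_sum_le H horth hone (hV.comp _ Subtype.val_injective) _ D
        (hD _ (Nat.le_add_right r k)) _ hS
    have h2 : prefixState ρ V w (r + (k + 1)) - prefixState ρ V w r =
        (prefixState ρ V w (r + k + 1) - prefixState ρ V w (r + k)) +
          (prefixState ρ V w (r + k) - prefixState ρ V w r) := by
      rw [sub_add_sub_cancel, add_assoc]
    rw [h2, Matrix.mul_add, Matrix.trace_add]
    refine (norm_add_le _ _).trans ((add_le_add h1 (ih (by omega))).trans_eq ?_)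
    push_cast
    ring

end Prefix

lemma minDist_le_hammingNorm {n r m : ℕ} (PC : Matrix (Fin r) (Fin n) (ZMod 2))
    (PK : Matrix (Fin m) (Fin n) (ZMod 2)) (j : Fin (r + m)) (hj : r ≤ (j : ℕ))
    (t : {i : Fin (r + m) // i < j} → ZMod 2) :
    minDist PC PK ≤ hammingNorm (codeRows PC PK j + ∑ i, t i • codeRows PC PK i) := by
  have h1 : minDist PC PK ≤ distToSubspace (codeRows PC PK j)
      (Submodule.span (ZMod 2) (codeRows PC PK '' {i | i < j})) :=
    Nat.sInf_le ⟨j, hj, rfl⟩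
  refine h1.trans (Nat.sInf_le ⟨∑ i, t i • codeRows PC PK i, ?_, ?_⟩)
  · exact Submodule.sum_mem _ fun i _ => Submodule.smul_mem _ _
      (Submodule.subset_span (Set.mem_image_of_mem _ i.2))
  · exact hammingDist_eq_hammingNorm_add _ _

/-! ### Comparison of two keys with the same syndrome -/

section Keys

variable {α β : Type*} {n r m : ℕ}

/-- The average of a family of states over the strings of given syndrome and key. -/
def keyAverage (ρ : BitString n → Matrix α α ℂ) (PC : Matrix (Fin r) (Fin n) (ZMod 2))
    (PK : Matrix (Fin m) (Fin n) (ZMod 2)) (ξ : BitString r) (k : BitString m) : Matrix α α ℂ :=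
  ((2 : ℂ) ^ (n - r - m))⁻¹ •
    ∑ x ∈ Finset.univ.filter (fun x : BitString n => PC.mulVec x = ξ ∧ PK.mulVec x = k), ρ x

lemma keyAverage_eq_prefixState (ρ : BitString n → Matrix α α ℂ)
    {PC : Matrix (Fin r) (Fin n) (ZMod 2)} {PK : Matrix (Fin m) (Fin n) (ZMod 2)}
    (hrows : LinearIndependent (ZMod 2) (codeRows PC PK)) (ξ : BitString r) (k : BitString m) :
    keyAverage ρ PC PK ξ k = prefixState ρ (codeRows PC PK) (Fin.append ξ k) (r + m) := by
  -- Ensures that the exponent `n - r - m` is not truncated.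
  have hle : r + m ≤ n := by
    have := hrows.fintype_card_le_finrank
    simpa using this
  unfold keyAverage prefixState
  rw [Finset.sum_filter]
  congr 1
  · rw [Nat.sub_sub, pow_sub₀ _ two_ne_zero hle, mul_inv, inv_inv, mul_comm]
  · refine Finset.sum_congr rfl fun x _ => ?_
    have h : (PC.mulVec x = ξ ∧ PK.mulVec x = k) ↔
        ∀ i : Fin (r + m), (i : ℕ) < r + m → codeRows PC PK i ⬝ᵥ x = Fin.append ξ k i := by
      rw [funext_iff, funext_iff]
      constructor
      · rintro ⟨h1, h2⟩ i -
        refine Fin.addCases (fun i => ?_) (fun i => ?_) i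
        · simp only [codeRows, Fin.append_left]
          exact h1 i
        · simp only [codeRows, Fin.append_right]
          exact h2 i
      · intro h
        refine ⟨fun i => ?_, fun i => ?_⟩
        · have := h (Fin.castAdd m i) (Fin.isLt _)
          simp only [codeRows, Fin.append_left] at this
          exact this
        · have := h (Fin.natAdd r i) (Fin.isLt _)
          simp only [codeRows, Fin.append_right] at this
          exact this
    simp only [h]

lemma keyAverage_isHermitian {ρ : BitString n → Matrix α α ℂ} (hρ : ∀ x, (ρ x).IsHermitian)
    (PC : Matrix (Fin r) (Fin n) (ZMod 2)) (PK : Matrix (Fin m) (Fin n) (ZMod 2))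
    (ξ : BitString r) (k : BitString m) : (keyAverage ρ PC PK ξ k).IsHermitian := by
  unfold keyAverage Matrix.IsHermitian
  rw [Matrix.conjTranspose_smul, Matrix.conjTranspose_sum]
  congr 1
  · simp
  · exact Finset.sum_congr rfl fun x _ => hρ x

lemma traceDist_keyAverage_le [Fintype α] [DecidableEq α] [Fintype β]
    (H : BitString n → Matrix α β ℂ)
    (horth : ∀ d d', d ≠ d' → (H d * (H d').conjTranspose).trace = 0)
    (hone : ∑ d, normSq (H d) = 1) {ρ : BitString n → Matrix α α ℂ}
    (hρ : ∀ x, ρ x = (∑ d, bitSign (x ⬝ᵥ d) • H d) *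
      (∑ d, bitSign (x ⬝ᵥ d) • H d).conjTranspose)
    {PC : Matrix (Fin r) (Fin n) (ZMod 2)} {PK : Matrix (Fin m) (Fin n) (ZMod 2)}
    (hrows : LinearIndependent (ZMod 2) (codeRows PC PK)) (ξ : BitString r) (k k' : BitString m) :
    traceDist (keyAverage ρ PC PK ξ k) (keyAverage ρ PC PK ξ k') ≤
      2 * m * Real.sqrt (tailWeight (fun d => normSq (H d)) (minDist PC PK)) := by
  have hherm : ∀ x, (ρ x).IsHermitian := fun x => by
    rw [hρ]
    exact Matrix.isHermitian_mul_conjTranspose_self _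
  refine traceDist_le_of_unitary (keyAverage_isHermitian hherm _ _ _ _)
    (keyAverage_isHermitian hherm _ _ _ _) fun S hS => ?_
  rw [keyAverage_eq_prefixState ρ hrows, keyAverage_eq_prefixState ρ hrows]
  have hb := fun w => norm_trace_prefixState_sub_le H horth hone hρ hrows w
    (minDist_le_hammingNorm PC PK) hS m le_rfl
  have h1 := hb (Fin.append ξ k)
  have h2 := hb (Fin.append ξ k')
  -- The first r parities are the syndrome, so both chains start from one state.
  have h3 : prefixState ρ (codeRows PC PK) (Fin.append ξ k') r =
      prefixState ρ (codeRows PC PK) (Fin.append ξ k) r := by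
    refine prefixState_congr _ _ fun i hi => ?_
    obtain ⟨i, rfl⟩ : ∃ i' : Fin r, i = Fin.castAdd m i' := ⟨⟨i, hi⟩, rfl⟩
    simp
  rw [h3] at h2
  set A := prefixState ρ (codeRows PC PK) (Fin.append ξ k) (r + m)
  set B := prefixState ρ (codeRows PC PK) (Fin.append ξ k') (r + m)
  set C := prefixState ρ (codeRows PC PK) (Fin.append ξ k) r
  have h4 : (S * (A - B)).trace = (S * (A - C)).trace - (S * (B - C)).trace := by
    rw [← Matrix.trace_sub, ← Matrix.mul_sub, sub_sub_sub_cancel_right]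
  rw [h4]
  refine (norm_sub_le _ _).trans ((add_le_add h1 h2).trans_eq ?_)
  ring

end Keys

/-! ## Tensor products of matrices -/

section PiMatrix

variable {ι : Type*} [Fintype ι] {α γ δ : ι → Type*}

/-- The tensor product of a family of matrices. -/
def piMatrix (A : ∀ l, Matrix (α l) (γ l) ℂ) : Matrix (∀ l, α l) (∀ l, γ l) ℂ :=
  fun f g => ∏ l, A l (f l) (g l)

lemma prod_sum_eq_sum_prod [DecidableEq ι] [∀ l, Fintype (γ l)] (F : ∀ l, γ l → ℂ) :
    ∏ l, ∑ u, F l u = ∑ u : ∀ l, γ l, ∏ l, F l (u l) := by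
  classical
  rw [Finset.prod_univ_sum, Fintype.piFinset_univ]

lemma conjTranspose_piMatrix (A : ∀ l, Matrix (α l) (γ l) ℂ) :
    (piMatrix A).conjTranspose = piMatrix fun l => (A l).conjTranspose := by
  ext f g
  simp only [piMatrix, Matrix.conjTranspose_apply]
  exact map_prod (starRingEnd ℂ) _ _

variable [DecidableEq ι]

lemma piMatrix_mul [∀ l, Fintype (γ l)] (A : ∀ l, Matrix (α l) (γ l) ℂ)
    (B : ∀ l, Matrix (γ l) (δ l) ℂ) :
    piMatrix A * piMatrix B = piMatrix fun l => A l * B l := by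
  ext f g
  simp only [piMatrix, Matrix.mul_apply, prod_sum_eq_sum_prod, Finset.prod_mul_distrib]

lemma trace_piMatrix [∀ l, Fintype (α l)] (A : ∀ l, Matrix (α l) (α l) ℂ) :
    (piMatrix A).trace = ∏ l, (A l).trace := by
  simp only [Matrix.trace, Matrix.diag, piMatrix, prod_sum_eq_sum_prod]

lemma normSq_piMatrix [∀ l, Fintype (α l)] [∀ l, Fintype (γ l)]
    (A : ∀ l, Matrix (α l) (γ l) ℂ) : normSq (piMatrix A) = ∏ l, normSq (A l) := by
  have h : ((normSq (piMatrix A) : ℝ) : ℂ) = ((∏ l, normSq (A l) : ℝ) : ℂ) := by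
    rw [← trace_mul_conjTranspose_self, conjTranspose_piMatrix, piMatrix_mul, trace_piMatrix,
      Complex.ofReal_prod]
    simp only [trace_mul_conjTranspose_self]
  exact_mod_cast h

lemma sum_bitSign_smul_piMatrix (η : ∀ l, ZMod 2 → Matrix (α l) (γ l) ℂ) (x : ι → ZMod 2) :
    ∑ d : ι → ZMod 2, bitSign (x ⬝ᵥ d) • piMatrix (fun l => η l (d l)) =
      piMatrix fun l => ∑ b, bitSign (x l * b) • η l b := by
  ext f g
  simp only [Matrix.sum_apply, Matrix.smul_apply, piMatrix, smul_eq_mul, prod_sum_eq_sum_prod,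
    dotProduct, bitSign_sum, Finset.prod_mul_distrib]

end PiMatrix

/-! ## Purifications of a pair of states with real overlap -/

section Dilation

variable {α τ : Type*}

/-- Half of 1 + star ω times g is then the real part of g; the phase is g / star g. -/
lemma exists_phase (g : ℂ) : ∃ ω : ℂ, ω * star ω = 1 ∧ star ω * g = star g := by
  by_cases hg : g = 0
  · exact ⟨1, by simp, by simp [hg]⟩
  · have hg' : star g ≠ 0 := star_ne_zero.mpr hg
    refine ⟨g / star g, ?_, ?_⟩
    · rw [star_div₀, star_star]
      field_simp
    · rw [star_div₀, star_star]
      field_simp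

/-- The tensor product of a matrix with the vector `c ψ` of a qubit. -/
def phaseExtension (c : ℂ) (ψ : ZMod 2 → ℂ) (X : Matrix α τ ℂ) : Matrix α (τ × ZMod 2) ℂ :=
  fun e u => c * (ψ u.2 * X e u.1)

lemma phaseExtension_mul_conjTranspose [Fintype τ] {c : ℂ} (hc : c * star c = 1 / 2)
    (ψ ψ' : ZMod 2 → ℂ) (X Y : Matrix α τ ℂ) :
    phaseExtension c ψ X * (phaseExtension c ψ' Y).conjTranspose =
      ((ψ 0 * star (ψ' 0) + ψ 1 * star (ψ' 1)) / 2) • (X * Y.conjTranspose) := by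
  ext e e'
  simp only [Matrix.mul_apply, Matrix.conjTranspose_apply, Matrix.smul_apply, smul_eq_mul,
    phaseExtension, Fintype.sum_prod_type, sum_zmod_two, star_mul']
  rw [Finset.mul_sum]
  refine Finset.sum_congr rfl fun t _ => ?_
  linear_combination ((ψ 0 * star (ψ' 0) + ψ 1 * star (ψ' 1)) * (X e t * star (Y e' t))) * hc

variable [Fintype α] [Fintype τ]

/-- An extra qubit, in the state (1,1)/√2 for A and (1,ω)/√2 for B, replaces the overlap by its real
part. Rotating B by a phase could also make the overlap real, but would alter that real part and
hence the norms of A ± B. -/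
lemma exists_purifications_real_overlap (A B : Matrix α τ ℂ) :
    ∃ M₀ M₁ : Matrix α (τ × ZMod 2) ℂ,
      M₀ * M₀.conjTranspose = A * A.conjTranspose ∧
      M₁ * M₁.conjTranspose = B * B.conjTranspose ∧
      (M₀ * M₁.conjTranspose).trace =
        ((A * B.conjTranspose).trace + (B * A.conjTranspose).trace) / 2 ∧
      (M₁ * M₀.conjTranspose).trace =
        ((A * B.conjTranspose).trace + (B * A.conjTranspose).trace) / 2 := by
  obtain ⟨ω, hω, hg⟩ := exists_phase (A * B.conjTranspose).trace
  have hBA : star (A * B.conjTranspose).trace = (B * A.conjTranspose).trace := by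
    rw [← Matrix.trace_conjTranspose, Matrix.conjTranspose_mul, Matrix.conjTranspose_conjTranspose]
  have hg' : ω * (B * A.conjTranspose).trace = (A * B.conjTranspose).trace := by
    rw [← hBA, ← hg, ← mul_assoc, hω, one_mul]
  rw [hBA] at hg
  obtain ⟨c, hc⟩ : ∃ c : ℂ, c * star c = 1 / 2 := by
    refine ⟨((Real.sqrt (1 / 2) : ℝ) : ℂ), ?_⟩
    rw [RCLike.star_def, Complex.conj_ofReal, ← Complex.ofReal_mul,
      Real.mul_self_sqrt (by norm_num)]
    norm_num
  let φ : ZMod 2 → ℂ := fun s => if s = 0 then 1 else ω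
  have h1 : (1 + 1 : ℂ) / 2 = 1 := by norm_num
  have hW := fun ψ ψ' X Y => phaseExtension_mul_conjTranspose (α := α) (τ := τ) hc ψ ψ' X Y
  refine ⟨phaseExtension c (fun _ => 1) A, phaseExtension c φ B, ?_, ?_, ?_, ?_⟩
  · rw [hW, star_one, mul_one, h1, one_smul]
  · rw [hW]
    simp only [φ, if_true, one_ne_zero, if_false, star_one, mul_one, hω, h1, one_smul]
  · rw [hW, Matrix.trace_smul]
    simp only [φ, if_true, one_ne_zero, if_false, star_one, mul_one, one_mul, smul_eq_mul]
    linear_combination hg / 2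
  · rw [hW, Matrix.trace_smul]
    simp only [φ, if_true, one_ne_zero, if_false, star_one, mul_one, smul_eq_mul]
    linear_combination hg' / 2

lemma normSq_add_bitSign_smul (A B : Matrix α τ ℂ) (b : ZMod 2) :
    (normSq (A + bitSign b • B) : ℂ) = normSq A + normSq B +
      bitSign b * ((A * B.conjTranspose).trace + (B * A.conjTranspose).trace) := by
  simp only [← trace_mul_conjTranspose_self, Matrix.conjTranspose_add, Matrix.conjTranspose_smul,
    Matrix.add_mul, Matrix.mul_add, Matrix.trace_add, Matrix.smul_mul, Matrix.mul_smul,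
    Matrix.trace_smul, smul_eq_mul, star_bitSign]
  linear_combination (B * B.conjTranspose).trace * bitSign_mul_self b

lemma normSq_smul (c : ℂ) (A : Matrix α τ ℂ) : normSq (c • A) = ‖c‖ ^ 2 * normSq A := by
  simp only [normSq, Matrix.smul_apply, smul_eq_mul, norm_mul, mul_pow, Finset.mul_sum]

/-- The half-sum and half-difference of two unit vectors with real overlap are orthogonal. Their
norms involve only the real part of the overlap, which the purifications preserve. -/
lemma exists_orthogonal_decomposition {A B : Matrix α τ ℂ} (hA : normSq A = 1)
    (hB : normSq B = 1) :
    ∃ η : ZMod 2 → Matrix α (τ × ZMod 2) ℂ,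
      (∑ b, bitSign (0 * b) • η b) * (∑ b, bitSign (0 * b) • η b).conjTranspose =
        A * A.conjTranspose ∧
      (∑ b, bitSign (1 * b) • η b) * (∑ b, bitSign (1 * b) • η b).conjTranspose =
        B * B.conjTranspose ∧
      (∀ b b', b ≠ b' → (η b * (η b').conjTranspose).trace = 0) ∧
      ∀ b, normSq (η b) = normSq (A + bitSign b • B) / 4 := by
  obtain ⟨M₀, M₁, h₀, h₁, h₀₁, h₁₀⟩ := exists_purifications_real_overlap A B
  have n₀ : (normSq M₀ : ℂ) = 1 := by
    rw [← trace_mul_conjTranspose_self, h₀, trace_mul_conjTranspose_self, hA, Complex.ofReal_one]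
  have n₁ : (normSq M₁ : ℂ) = 1 := by
    rw [← trace_mul_conjTranspose_self, h₁, trace_mul_conjTranspose_self, hB, Complex.ofReal_one]
  refine ⟨fun b => (1 / 2 : ℂ) • (M₀ + bitSign b • M₁), ?_, ?_, ?_, ?_⟩
  · rw [← h₀]
    have : ∑ b, bitSign (0 * b) • (1 / 2 : ℂ) • (M₀ + bitSign b • M₁) = M₀ := by
      rw [sum_zmod_two]
      simp only [zero_mul, bitSign_zero, bitSign_one]
      module
    rw [this]
  · rw [← h₁]
    have : ∑ b, bitSign (1 * b) • (1 / 2 : ℂ) • (M₀ + bitSign b • M₁) = M₁ := by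
      rw [sum_zmod_two]
      simp only [one_mul, bitSign_zero, bitSign_one]
      module
    rw [this]
  · intro b b' hb
    have hs : bitSign b' = -bitSign b := by
      rcases zmod_two_cases b with rfl | rfl <;> rcases zmod_two_cases b' with rfl | rfl <;>
        simp at hb ⊢
    simp only [hs, Matrix.conjTranspose_add, Matrix.conjTranspose_smul, Matrix.add_mul,
      Matrix.mul_add, Matrix.trace_add, Matrix.smul_mul, Matrix.mul_smul, Matrix.trace_smul,
      smul_eq_mul, star_neg, star_bitSign, h₀₁, h₁₀, trace_mul_conjTranspose_self, n₀, n₁]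
    linear_combination (-(1 / 2 * star (1 / 2 : ℂ))) * bitSign_mul_self b
  · intro b
    have h : (normSq (M₀ + bitSign b • M₁) : ℂ) = normSq (A + bitSign b • B) := by
      rw [normSq_add_bitSign_smul, normSq_add_bitSign_smul, n₀, n₁, h₀₁, h₁₀, hA, hB]
      push_cast
      ring
    rw [normSq_smul, Complex.ofReal_inj.mp h]
    norm_num
    ring

end Dilation

/-! ## A single attacked qubit -/

namespace CollectiveAttack

variable {N : ℕ} (A : CollectiveAttack N)

/-- The probability of the error `c` in the `j`-th bit, for a uniformly random bit encoded and
measured in the basis `β`. -/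
def errProb (j : Fin N) (β c : ZMod 2) : ℝ := (∑ a, A.bobProb j β a (a + c)) / 2

lemma bobProb_nonneg (j : Fin N) (β a y : ZMod 2) : 0 ≤ A.bobProb j β a y := by
  unfold bobProb; positivity

lemma errProb_nonneg (j : Fin N) (β c : ZMod 2) : 0 ≤ A.errProb j β c :=
  div_nonneg (Finset.sum_nonneg fun _ _ => A.bobProb_nonneg _ _ _ _) zero_le_two

lemma sum_norm_sq_ket (β a : ZMod 2) : ∑ t, ‖ket β a t‖ ^ 2 = 1 := by
  have h : (√2 : ℝ) ^ 2 = 2 := Real.sq_sqrt zero_le_two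
  rw [sum_zmod_two]
  rcases zmod_two_cases β with rfl | rfl <;> rcases zmod_two_cases a with rfl | rfl <;>
    simp [ket] <;> norm_num

lemma sum_norm_sq_mulVec_unitary {ν : Type*} [Fintype ν] [DecidableEq ν]
    (U : Matrix.unitaryGroup ν ℂ) (v : ν → ℂ) :
    ∑ p, ‖(U : Matrix ν ν ℂ).mulVec v p‖ ^ 2 = ∑ p, ‖v p‖ ^ 2 := by
  have h : ∀ u : ν → ℂ, ((∑ p, ‖u p‖ ^ 2 : ℝ) : ℂ) = star u ⬝ᵥ u := by
    intro u
    rw [Complex.ofReal_sum]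
    refine Finset.sum_congr rfl fun p _ => ?_
    rw [Pi.star_apply, mul_comm, RCLike.star_def, Complex.mul_conj, Complex.normSq_eq_norm_sq]
  have h1 : ((∑ p, ‖(U : Matrix ν ν ℂ).mulVec v p‖ ^ 2 : ℝ) : ℂ) = (∑ p, ‖v p‖ ^ 2 : ℝ) := by
    rw [h, h, Matrix.star_mulVec, ← Matrix.dotProduct_mulVec, Matrix.mulVec_mulVec,
      ← Matrix.star_eq_conjTranspose, (Unitary.mem_iff.mp U.2).1, Matrix.one_mulVec]
  exact_mod_cast h1

lemma sum_norm_sq_evolved (j : Fin N) (β a : ZMod 2) :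
    ∑ e, ∑ t, ‖A.evolved j β a (e, t)‖ ^ 2 = 1 := by
  rw [← Fintype.sum_prod_type (fun p => ‖A.evolved j β a p‖ ^ 2)]
  unfold evolved
  rw [sum_norm_sq_mulVec_unitary, Fintype.sum_prod_type]
  simp only [norm_mul, mul_pow, ← Finset.mul_sum, sum_norm_sq_ket, mul_one]
  exact A.init_normalized j

lemma ket_one (a t : ZMod 2) :
    ket 1 a t = (√2 : ℂ)⁻¹ * (ket 0 0 t + bitSign a * ket 0 1 t) := by
  rcases zmod_two_cases a with rfl | rfl <;> rcases zmod_two_cases t with rfl | rfl <;>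
    simp [ket, neg_div]

lemma evolved_one (j : Fin N) (a : ZMod 2) (p : Fin (A.dim j) × ZMod 2) :
    A.evolved j 1 a p =
      (√2 : ℂ)⁻¹ * (A.evolved j 0 0 p + bitSign a * A.evolved j 0 1 p) := by
  have h : (fun p : Fin (A.dim j) × ZMod 2 => A.init j p.1 * ket 1 a p.2) =
      (√2 : ℂ)⁻¹ • ((fun p => A.init j p.1 * ket 0 0 p.2) +
        bitSign a • fun p => A.init j p.1 * ket 0 1 p.2) := by
    funext p
    simp only [ket_one, Pi.smul_apply, Pi.add_apply, smul_eq_mul]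
    ring
  unfold evolved
  rw [h, Matrix.mulVec_smul, Matrix.mulVec_add, Matrix.mulVec_smul]
  rfl

/-- The joint state of the `j`-th probe and the `j`-th qubit, as a matrix, with the qubit flipped
by the Pauli matrix `X` if Alice sent `|1⟩`. -/
def aligned (j : Fin N) (a : ZMod 2) : Matrix (Fin (A.dim j)) (ZMod 2) ℂ :=
  fun e t => A.evolved j 0 a (e, t + a)

lemma normSq_aligned (j : Fin N) (a : ZMod 2) : normSq (A.aligned j a) = 1 := by
  rw [← A.sum_norm_sq_evolved j 0 a]
  exact Finset.sum_congr rfl fun e _ =>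
    Equiv.sum_comp (Equiv.addRight a) fun t => ‖A.evolved j 0 a (e, t)‖ ^ 2

/-- The flip acts on the qubit that is traced out, so Eve's state does not see it. -/
lemma aligned_mul_conjTranspose (j : Fin N) (a : ZMod 2) :
    A.aligned j a * (A.aligned j a).conjTranspose = A.probeState j 0 a := by
  ext e e'
  exact Equiv.sum_comp (Equiv.addRight a)
    fun t => A.evolved j 0 a (e, t) * star (A.evolved j 0 a (e', t))

lemma norm_sq_add_norm_sq_sub (z w : ℂ) :
    ‖z + w‖ ^ 2 + ‖z - w‖ ^ 2 = 2 * (‖z‖ ^ 2 + ‖w‖ ^ 2) := by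
  have := parallelogram_law_with_norm ℝ z w
  nlinarith

lemma probeVec_one (j : Fin N) (a y : ZMod 2) (e : Fin (A.dim j)) :
    A.probeVec j 1 a y e = (1 / 2) *
      (A.evolved j 0 0 (e, 0) + bitSign a * A.evolved j 0 1 (e, 0) +
        bitSign y * (A.evolved j 0 0 (e, 1) + bitSign a * A.evolved j 0 1 (e, 1))) := by
  have h : (√2 : ℂ)⁻¹ * (√2 : ℂ)⁻¹ = 1 / 2 := by
    rw [← mul_inv, ← Complex.ofReal_mul, Real.mul_self_sqrt zero_le_two]
    norm_num
  have hs : star ((√2 : ℂ)⁻¹) = (√2 : ℂ)⁻¹ := by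
    rw [RCLike.star_def, map_inv₀, Complex.conj_ofReal]
  unfold probeVec
  rw [sum_zmod_two, evolved_one, evolved_one, ket_one, ket_one, star_mul', star_mul', hs, ← h]
  rcases zmod_two_cases y with rfl | rfl <;> simp [ket] <;> ring

/-- The flip aligns the components so that, for a fixed error, Bob's amplitudes for Alice's two `x`
states are the sum and the difference of the columns of the combination, up to sign and the factor
1/2; the parallelogram law adds them. -/
lemma errProb_one (j : Fin N) (b' : ZMod 2) :
    A.errProb j 1 b' = normSq (A.aligned j 0 + bitSign b' • A.aligned j 1) / 4 := by
  have h11 : (1 + 1 : ZMod 2) = 0 := by decide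
  unfold errProb bobProb normSq
  rw [Finset.sum_comm, Finset.sum_div, Finset.sum_div]
  refine Finset.sum_congr rfl fun e _ => ?_
  simp only [sum_zmod_two, probeVec_one, Matrix.add_apply, Matrix.smul_apply, aligned, smul_eq_mul,
    zero_add, add_zero, h11, norm_mul, mul_pow, bitSign_zero, bitSign_one, one_mul]
  set a := A.evolved j 0 0 (e, 0)
  set b := A.evolved j 0 0 (e, 1)
  set c := A.evolved j 0 1 (e, 0)
  set d := A.evolved j 0 1 (e, 1)
  have h2 : ‖(1 / 2 : ℂ)‖ ^ 2 = 1 / 4 := by norm_num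
  rw [h2]
  rcases zmod_two_cases b' with rfl | rfl
  · have h := norm_sq_add_norm_sq_sub (a + d) (b + c)
    simp only [add_zero, bitSign_zero, bitSign_one, one_mul]
    rw [show a + d + (b + c) = a + c + (b + d) by ring,
      show a + d - (b + c) = a + -1 * c + -1 * (b + -1 * d) by ring] at h
    linear_combination h / 8
  · have h := norm_sq_add_norm_sq_sub (a - d) (b - c)
    simp only [h11, bitSign_zero, bitSign_one, one_mul]
    rw [show a - d + (b - c) = a + -1 * c + (b + -1 * d) by ring,
      show a - d - (b - c) = a + c + -1 * (b + d) by ring,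
      show a - d = a + -1 * d by ring, show b - c = b + -1 * c by ring] at h
    linear_combination h / 8

lemma exists_probe_decomposition (j : Fin N) :
    ∃ η : ZMod 2 → Matrix (Fin (A.dim j)) (ZMod 2 × ZMod 2) ℂ,
      (∀ a, A.probeState j 0 a =
        (∑ b, bitSign (a * b) • η b) * (∑ b, bitSign (a * b) • η b).conjTranspose) ∧
      (∀ b b', b ≠ b' → (η b * (η b').conjTranspose).trace = 0) ∧
      ∀ b, normSq (η b) = A.errProb j 1 b := by
  obtain ⟨η, h₀, h₁, ho, hn⟩ :=
    exists_orthogonal_decomposition (A.normSq_aligned j 0) (A.normSq_aligned j 1)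
  refine ⟨η, fun a => ?_, ho, fun b => by rw [hn, errProb_one]⟩
  rcases zmod_two_cases a with rfl | rfl
  · rw [h₀, aligned_mul_conjTranspose]
  · rw [h₁, aligned_mul_conjTranspose]

lemma sum_norm_sq_ket_component (β : ZMod 2) (z : ZMod 2 → ℂ) :
    ∑ y, ‖∑ t, star (ket β y t) * z t‖ ^ 2 = ∑ t, ‖z t‖ ^ 2 := by
  have h2 : ‖(√2 : ℂ)‖ ^ 2 = 2 := by
    rw [Complex.norm_real, Real.norm_eq_abs, sq_abs, Real.sq_sqrt zero_le_two]
  simp only [sum_zmod_two]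
  rcases zmod_two_cases β with rfl | rfl
  · simp [ket]
  · have h := norm_sq_add_norm_sq_sub (z 0) (z 1)
    have h0 : star (ket 1 0 0) * z 0 + star (ket 1 0 1) * z 1 = (z 0 + z 1) / (√2 : ℂ) := by
      simp [ket]
      ring
    have h1 : star (ket 1 1 0) * z 0 + star (ket 1 1 1) * z 1 = (z 0 - z 1) / (√2 : ℂ) := by
      simp [ket]
      ring
    rw [h0, h1, norm_div, norm_div, div_pow, div_pow, h2]
    linear_combination h / 2

lemma sum_errProb (j : Fin N) (β : ZMod 2) : ∑ c, A.errProb j β c = 1 := by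
  have h : ∀ a, ∑ c, A.bobProb j β a (a + c) = 1 := by
    intro a
    rw [← A.sum_norm_sq_evolved j β a]
    unfold bobProb
    rw [Finset.sum_comm]
    refine Finset.sum_congr rfl fun e _ => ?_
    rw [← sum_norm_sq_ket_component β (fun t => A.evolved j β a (e, t))]
    exact Equiv.sum_comp (Equiv.addLeft a) fun y => ‖A.probeVec j β a y e‖ ^ 2
  unfold errProb
  rw [← Finset.sum_div, Finset.sum_comm]
  simp only [h]
  rw [sum_zmod_two]
  norm_num

end CollectiveAttack

/-! ## Splitting the bits according to a partition -/

lemma mem_range_positions {N k : ℕ} (s : BitString N) (hs : hammingNorm s = k) (j : Fin N) :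
    j ∈ Set.range (positions s hs) ↔ s j ≠ 0 := by
  have h : Set.range (positions s hs) = (Finset.univ.filter fun j => s j ≠ 0 : Finset (Fin N)) :=
    Finset.range_orderEmbOfFin _ hs
  rw [h]
  simp

lemma apply_positions {N k : ℕ} (s : BitString N) (hs : hammingNorm s = k) (l : Fin k) :
    s (positions s hs l) = 1 :=
  (zmod_two_cases _).resolve_left ((mem_range_positions s hs _).mp ⟨l, rfl⟩)

namespace BitPartition

variable {n nz nx : ℕ} (P : BitPartition n nz nx)

/-- The position, among all the bits, of the `l`-th TEST-Z bit. -/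
def testZPos (l : Fin nz) : Fin (n + nz + nx) := positions P.z P.weight_z l

/-- The position, among all the bits, of the `l`-th TEST-X bit. -/
def testXPos (l : Fin nx) : Fin (n + nz + nx) := positions P.b P.weight_b l

/-- The map that lists the INFO, the TEST-Z and the TEST-X bits. -/
def position : Fin n ⊕ Fin nz ⊕ Fin nx → Fin (n + nz + nx) :=
  Sum.elim P.infoPos (Sum.elim P.testZPos P.testXPos)

/-- A string of full weight vanishes nowhere, so every position is listed at least once; the
cardinalities then exclude repetitions. -/
lemma position_bijective : Function.Bijective P.position := by
  rw [Fintype.bijective_iff_surjective_and_card]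
  refine ⟨fun j => ?_, by simp [add_assoc]⟩
  have hj : (P.s + P.z + P.b) j ≠ 0 := by
    have h := P.weight_add
    unfold hammingNorm at h
    have h' : (Finset.univ.filter fun j => (P.s + P.z + P.b) j ≠ 0) = Finset.univ := by
      rw [← Finset.card_eq_iff_eq_univ, h, Fintype.card_fin]
    have hmem : j ∈ Finset.univ.filter fun j => (P.s + P.z + P.b) j ≠ 0 := by
      rw [h']
      exact Finset.mem_univ j
    exact (Finset.mem_filter.mp hmem).2
  by_cases hs : P.s j = 0
  · by_cases hz : P.z j = 0
    · have hb : P.b j ≠ 0 := by simpa [hs, hz] using hj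
      obtain ⟨l, hl⟩ := (mem_range_positions P.b P.weight_b j).mpr hb
      exact ⟨Sum.inr (Sum.inr l), hl⟩
    · obtain ⟨l, hl⟩ := (mem_range_positions P.z P.weight_z j).mpr hz
      exact ⟨Sum.inr (Sum.inl l), hl⟩
  · obtain ⟨l, hl⟩ := (mem_range_positions P.s P.weight_s j).mpr hs
    exact ⟨Sum.inl l, hl⟩

lemma b_infoPos (l : Fin n) : P.b (P.infoPos l) = 0 := by
  by_contra h
  obtain ⟨l', hl'⟩ := (mem_range_positions P.b P.weight_b _).mpr h
  have := P.position_bijective.1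
    (show P.position (Sum.inr (Sum.inr l')) = P.position (Sum.inl l) from hl')
  simp at this

lemma b_testZPos (l : Fin nz) : P.b (P.testZPos l) = 0 := by
  by_contra h
  obtain ⟨l', hl'⟩ := (mem_range_positions P.b P.weight_b _).mpr h
  have := P.position_bijective.1
    (show P.position (Sum.inr (Sum.inr l')) = P.position (Sum.inr (Sum.inl l)) from hl')
  simp at this

lemma s_testZPos (l : Fin nz) : P.s (P.testZPos l) = 0 := by
  by_contra h
  obtain ⟨l', hl'⟩ := (mem_range_positions P.s P.weight_s _).mpr h
  have := P.position_bijective.1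
    (show P.position (Sum.inl l') = P.position (Sum.inr (Sum.inl l)) from hl')
  simp at this

lemma s_testXPos (l : Fin nx) : P.s (P.testXPos l) = 0 := by
  by_contra h
  obtain ⟨l', hl'⟩ := (mem_range_positions P.s P.weight_s _).mpr h
  have := P.position_bijective.1
    (show P.position (Sum.inl l') = P.position (Sum.inr (Sum.inr l)) from hl')
  simp at this

lemma b_testXPos (l : Fin nx) : P.b (P.testXPos l) = 1 := apply_positions _ _ l

lemma s_infoPos (l : Fin n) : P.s (P.infoPos l) = 1 := apply_positions _ _ l

lemma prod_eq_prod_position (F : Fin (n + nz + nx) → ℝ) :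
    ∏ j, F j = (∏ l, F (P.infoPos l)) * ((∏ l, F (P.testZPos l)) * ∏ l, F (P.testXPos l)) := by
  rw [← P.position_bijective.prod_comp, Fintype.prod_sum_type, Fintype.prod_sum_type]
  rfl

lemma split_bijective :
    Function.Bijective fun c : BitString (n + nz + nx) => (P.info c, P.testZ c, P.testX c) := by
  rw [Fintype.bijective_iff_injective_and_card]
  refine ⟨fun c c' h => ?_, by simp [pow_add, mul_assoc]⟩
  simp only [Prod.mk.injEq] at h
  funext j
  obtain ⟨l | l | l, rfl⟩ := P.position_bijective.2 j
  exacts [congrFun h.1 l, congrFun h.2.1 l, congrFun h.2.2 l]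

lemma sum_split (F : BitString n → ℝ) (G : BitString nz → BitString nx → ℝ) :
    ∑ c, F (P.info c) * G (P.testZ c) (P.testX c) = (∑ a, F a) * ∑ u, ∑ w, G u w := by
  rw [P.split_bijective.sum_comp (fun p => F p.1 * G p.2.1 p.2.2), Fintype.sum_prod_type,
    Finset.sum_mul]
  refine Finset.sum_congr rfl fun a _ => ?_
  rw [Fintype.sum_prod_type, Finset.mul_sum]
  exact Finset.sum_congr rfl fun u _ =>
    (Finset.mul_sum Finset.univ (fun w => G u w) (F a)).symm

end BitPartition

/-! ## Probabilities of error strings -/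

section Probability

variable {n nz nx : ℕ} (A : CollectiveAttack (n + nz + nx))

lemma prod_sum_eq_sum_prod_real {ι σ : Type*} [Fintype ι] [DecidableEq ι] [Fintype σ]
    (F : ι → σ → ℝ) : ∏ l, ∑ a, F l a = ∑ d : ι → σ, ∏ l, F l (d l) := by
  rw [Finset.prod_univ_sum, Fintype.piFinset_univ]

lemma sum_prod_errProb {t : ℕ} (pos : Fin t → Fin (n + nz + nx)) (β : Fin t → ZMod 2) :
    ∑ d : BitString t, ∏ l, A.errProb (pos l) (β l) (d l) = 1 := by
  rw [← prod_sum_eq_sum_prod_real fun l b => A.errProb (pos l) (β l) b]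
  simp only [A.sum_errProb, Finset.prod_const_one]

/-- Substituting iB = i + c and averaging over i, coordinate by coordinate, makes the bit errors
independent with laws `errProb`. -/
lemma sum_outcomeProb (bases : BitPartition n nz nx → BitString (n + nz + nx))
    (P : BitPartition n nz nx) (G : BitString (n + nz + nx) → ℝ) :
    ∑ i, ∑ iB, G (i + iB) * outcomeProb A bases P i iB =
      (Fintype.card (BitPartition n nz nx) : ℝ)⁻¹ *
        ∑ c, G c * ∏ j, A.errProb j (bases P j) (c j) := by
  have h1 : ∀ i, ∑ iB, G (i + iB) * outcomeProb A bases P i iB =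
      ∑ c, G c * outcomeProb A bases P i (i + c) := by
    intro i
    rw [← Equiv.sum_comp (Equiv.addLeft i)]
    refine Finset.sum_congr rfl fun c _ => ?_
    rw [Equiv.coe_addLeft, ← add_assoc, bits_add_self, zero_add]
  simp only [h1]
  rw [Finset.sum_comm, Finset.mul_sum]
  refine Finset.sum_congr rfl fun c _ => ?_
  have h2 : ∑ i : BitString (n + nz + nx), ∏ j, A.bobProb j (bases P j) (i j) ((i + c) j) =
      2 ^ (n + nz + nx) * ∏ j, A.errProb j (bases P j) (c j) := by
    simp only [Pi.add_apply]
    rw [← prod_sum_eq_sum_prod_real fun j a => A.bobProb j (bases P j) a (a + c j)]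
    simp only [CollectiveAttack.errProb]
    rw [Finset.prod_div_distrib, Finset.prod_const, Finset.card_univ, Fintype.card_fin]
    field_simp
  unfold outcomeProb
  rw [← Finset.mul_sum, ← Finset.mul_sum, h2]
  field_simp

/-- The probability that the tests are passed, given the partition. -/
def passProb (paz pax : ℝ) (P : BitPartition n nz nx) : ℝ :=
  open Classical in
  ∑ u : BitString nz, ∑ w : BitString nx,
    (if errorRate u ≤ paz ∧ errorRate w ≤ pax then 1 else 0) *
      ((∏ l, A.errProb (P.testZPos l) 0 (u l)) * ∏ l, A.errProb (P.testXPos l) 1 (w l))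

/-- The probability of a string of errors on the INFO bits in the `x` basis. -/
def infoErrProb (P : BitPartition n nz nx) (d : BitString n) : ℝ :=
  ∏ l, A.errProb (P.infoPos l) 1 (d l)

lemma passProb_nonneg (paz pax : ℝ) (P : BitPartition n nz nx) : 0 ≤ passProb A paz pax P := by
  refine Finset.sum_nonneg fun u _ => Finset.sum_nonneg fun w _ => mul_nonneg ?_ ?_
  · split_ifs
    exacts [zero_le_one, le_rfl]
  · exact mul_nonneg (Finset.prod_nonneg fun _ _ => A.errProb_nonneg _ _ _)
      (Finset.prod_nonneg fun _ _ => A.errProb_nonneg _ _ _)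

lemma passProb_le_one (paz pax : ℝ) (P : BitPartition n nz nx) : passProb A paz pax P ≤ 1 := by
  have h1 := sum_prod_errProb A P.testZPos fun _ => 0
  have h2 := sum_prod_errProb A P.testXPos fun _ => 1
  calc passProb A paz pax P
      ≤ ∑ u : BitString nz, ∑ w : BitString nx,
        ((∏ l, A.errProb (P.testZPos l) 0 (u l)) * ∏ l, A.errProb (P.testXPos l) 1 (w l)) := by
        refine Finset.sum_le_sum fun u _ => Finset.sum_le_sum fun w _ =>
          mul_le_of_le_one_left ?_ ?_
        · exact mul_nonneg (Finset.prod_nonneg fun _ _ => A.errProb_nonneg _ _ _)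
            (Finset.prod_nonneg fun _ _ => A.errProb_nonneg _ _ _)
        · split_ifs
          exacts [le_rfl, zero_le_one]
    _ = 1 := by
        rw [← Finset.sum_mul_sum, h1, h2, one_mul]

lemma eventProb_virtualBases (hn : 0 < n) (paz pax : ℝ) (D : ℕ) :
    eventProb A BitPartition.virtualBases (fun P i iB =>
        errorRate (P.info (i + iB)) ≥ (D : ℝ) / (2 * (n : ℝ)) ∧
          errorRate (P.testZ (i + iB)) ≤ paz ∧ errorRate (P.testX (i + iB)) ≤ pax) =
      ∑ P, (Fintype.card (BitPartition n nz nx) : ℝ)⁻¹ *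
        (tailWeight (infoErrProb A P) D * passProb A paz pax P) := by
  classical
  -- Clearing denominators avoids halving a natural number.
  have hrate : ∀ a : BitString n,
      errorRate a ≥ (D : ℝ) / (2 * (n : ℝ)) ↔ D ≤ 2 * hammingNorm a := by
    intro a
    have hn' : (0 : ℝ) < n := Nat.cast_pos.mpr hn
    unfold errorRate
    rw [ge_iff_le, div_le_div_iff₀ (by positivity) hn', ← mul_assoc, mul_le_mul_iff_left₀ hn']
    rw [mul_comm]
    exact_mod_cast Iff.rfl
  unfold eventProb
  refine Finset.sum_congr rfl fun P _ => ?_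
  let F : BitString n → ℝ := fun a => if D ≤ 2 * hammingNorm a then 1 else 0
  let G : BitString nz → BitString nx → ℝ := fun u w =>
    if errorRate u ≤ paz ∧ errorRate w ≤ pax then 1 else 0
  have h1 := sum_outcomeProb A BitPartition.virtualBases P
    fun c => F (P.info c) * G (P.testZ c) (P.testX c)
  have h2 : ∀ c : BitString (n + nz + nx),
      ∏ j, A.errProb j (P.virtualBases j) (c j) = infoErrProb A P (P.info c) *
        ((∏ l, A.errProb (P.testZPos l) 0 (P.testZ c l)) *
          ∏ l, A.errProb (P.testXPos l) 1 (P.testX c l)) := by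
    intro c
    rw [P.prod_eq_prod_position]
    simp only [BitPartition.virtualBases, Pi.add_apply, P.b_infoPos, P.s_infoPos, P.b_testZPos,
      P.s_testZPos, P.b_testXPos, P.s_testXPos, zero_add, add_zero]
    rfl
  have h3 : ∀ c : BitString (n + nz + nx),
      F (P.info c) * G (P.testZ c) (P.testX c) * ∏ j, A.errProb j (P.virtualBases j) (c j) =
      (F (P.info c) * infoErrProb A P (P.info c)) * (G (P.testZ c) (P.testX c) *
        ((∏ l, A.errProb (P.testZPos l) 0 (P.testZ c l)) *
          ∏ l, A.errProb (P.testXPos l) 1 (P.testX c l))) := by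
    intro c
    rw [h2]
    ring
  simp only [h3] at h1
  rw [P.sum_split (fun a => F a * infoErrProb A P a) (fun u w => G u w *
        ((∏ l, A.errProb (P.testZPos l) 0 (u l)) * ∏ l, A.errProb (P.testXPos l) 1 (w l)))] at h1
  convert h1 using 1
  · refine Finset.sum_congr rfl fun i _ => Finset.sum_congr rfl fun iB _ => ?_
    simp only [hrate, F, G, ← ite_and, ite_mul, one_mul, zero_mul]
  · simp only [tailWeight, passProb, F, G, ite_mul, one_mul, zero_mul]

lemma sum_mul_sum_fiber {Y ι σ : Type*} [Fintype Y] [DecidableEq Y] [Fintype ι] [Fintype σ]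
    (g : Y → ℝ) (X : ι → σ → Y) (p : ι → σ → ℝ) :
    ∑ y, g y * ∑ i, ∑ k, (if X i k = y then p i k else 0) = ∑ i, ∑ k, g (X i k) * p i k := by
  simp only [Finset.mul_sum]
  rw [Finset.sum_comm]
  refine Finset.sum_congr rfl fun i _ => ?_
  rw [Finset.sum_comm]
  refine Finset.sum_congr rfl fun k _ => ?_
  rw [Finset.sum_eq_single (X i k) (fun y _ hy => by rw [if_neg hy.symm, mul_zero])
    (fun h => absurd (Finset.mem_univ _) h), if_pos rfl]

lemma eventProb_nonneg (bases : BitPartition n nz nx → BitString (n + nz + nx))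
    (E : BitPartition n nz nx → BitString (n + nz + nx) → BitString (n + nz + nx) → Prop) :
    0 ≤ eventProb A bases E := by
  refine Finset.sum_nonneg fun P _ => Finset.sum_nonneg fun i _ => Finset.sum_nonneg fun iB _ => ?_
  split_ifs
  · exact mul_nonneg (by positivity) (Finset.prod_nonneg fun j _ => A.bobProb_nonneg _ _ _ _)
  · exact le_rfl

/-- As g ignores the syndrome and the INFO errors, both are summed out, the latter with total
probability 1. -/
lemma sum_eventProb_realBases {r : ℕ} (PC : Matrix (Fin r) (Fin n) (ZMod 2))
    (P : BitPartition n nz nx) (g : BitString nz → BitString nx → ℝ) :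
    ∑ ξ : BitString r, ∑ cz : BitString nz, ∑ cb : BitString nx, g cz cb *
      eventProb A BitPartition.realBases (fun Q i iB =>
        Q = P ∧ PC.mulVec (Q.info i) = ξ ∧ Q.testZ (i + iB) = cz ∧ Q.testX (i + iB) = cb) =
      (Fintype.card (BitPartition n nz nx) : ℝ)⁻¹ * ∑ u : BitString nz, ∑ w : BitString nx, g u w *
        ((∏ l, A.errProb (P.testZPos l) 0 (u l)) * ∏ l, A.errProb (P.testXPos l) 1 (w l)) := by
  classical
  have h1 : ∀ (ξ : BitString r) (cz : BitString nz) (cb : BitString nx),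
      eventProb A BitPartition.realBases (fun Q i iB =>
        Q = P ∧ PC.mulVec (Q.info i) = ξ ∧ Q.testZ (i + iB) = cz ∧ Q.testX (i + iB) = cb) =
      ∑ i, ∑ iB, if (PC.mulVec (P.info i), P.testZ (i + iB), P.testX (i + iB)) = (ξ, cz, cb) then
        outcomeProb A BitPartition.realBases P i iB else 0 := by
    intro ξ cz cb
    unfold eventProb
    rw [Finset.sum_eq_single P]
    · refine Finset.sum_congr rfl fun i _ => Finset.sum_congr rfl fun iB _ => ?_
      simp only [true_and, Prod.mk.injEq]
    · intro Q _ hQ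
      simp only [hQ, false_and, if_false, Finset.sum_const_zero]
    · exact fun h => absurd (Finset.mem_univ _) h
  have h2 : ∀ c : BitString (n + nz + nx),
      ∏ j, A.errProb j (P.realBases j) (c j) = (∏ l, A.errProb (P.infoPos l) 0 (P.info c l)) *
        ((∏ l, A.errProb (P.testZPos l) 0 (P.testZ c l)) *
          ∏ l, A.errProb (P.testXPos l) 1 (P.testX c l)) := by
    intro c
    rw [P.prod_eq_prod_position]
    simp only [BitPartition.realBases, P.b_infoPos, P.b_testZPos, P.b_testXPos]
    rfl
  have h3 := sum_mul_sum_fiber (fun y : BitString r × BitString nz × BitString nx => g y.2.1 y.2.2)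
    (fun i iB => (PC.mulVec (P.info i), P.testZ (i + iB), P.testX (i + iB)))
    (outcomeProb A BitPartition.realBases P)
  have h4 := sum_outcomeProb A BitPartition.realBases P fun c => g (P.testZ c) (P.testX c)
  simp only [Fintype.sum_prod_type] at h3
  simp only [h1]
  rw [h3, h4]
  have h5 : ∀ c : BitString (n + nz + nx),
      g (P.testZ c) (P.testX c) * ∏ j, A.errProb j (P.realBases j) (c j) =
      (∏ l, A.errProb (P.infoPos l) 0 (P.info c l)) * (g (P.testZ c) (P.testX c) *
        ((∏ l, A.errProb (P.testZPos l) 0 (P.testZ c l)) *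
          ∏ l, A.errProb (P.testXPos l) 1 (P.testX c l))) := fun c => by
    rw [h2, mul_left_comm]
  simp only [h5]
  rw [P.sum_split (fun a => ∏ l, A.errProb (P.infoPos l) 0 (a l)) (fun u w => g u w *
    ((∏ l, A.errProb (P.testZPos l) 0 (u l)) * ∏ l, A.errProb (P.testXPos l) 1 (w l))),
    sum_prod_errProb, one_mul]

end Probability

/-! ## The trace distance for a given partition, and its average -/

section Main

variable {n nz nx r m : ℕ} (A : CollectiveAttack (n + nz + nx))

lemma tailWeight_nonneg (P : BitPartition n nz nx) (D : ℕ) :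
    0 ≤ tailWeight (infoErrProb A P) D := by
  refine Finset.sum_nonneg fun d _ => ?_
  split_ifs
  exacts [Finset.prod_nonneg fun _ _ => A.errProb_nonneg _ _ _, le_rfl]

lemma traceDist_eveKeyState_le (P : BitPartition n nz nx)
    {PC : Matrix (Fin r) (Fin n) (ZMod 2)} {PK : Matrix (Fin m) (Fin n) (ZMod 2)}
    (hrows : LinearIndependent (ZMod 2) (codeRows PC PK)) (ξ : BitString r) (k k' : BitString m) :
    traceDist (eveKeyState A P PC PK ξ k) (eveKeyState A P PC PK ξ k') ≤
      2 * m * Real.sqrt (tailWeight (infoErrProb A P) (minDist PC PK)) := by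
  choose η hη horth hnorm using fun l => A.exists_probe_decomposition (P.infoPos l)
  let H : BitString n → Matrix (EveIndex A P) (Fin n → ZMod 2 × ZMod 2) ℂ :=
    fun d => piMatrix fun l => η l (d l)
  have hH : ∀ d, normSq (H d) = infoErrProb A P d := by
    intro d
    simp only [H, normSq_piMatrix, hnorm]
    rfl
  have h := traceDist_keyAverage_le H (ρ := eveState A P) ?_ ?_ ?_ hrows ξ k k'
  · simp only [hH] at h
    exact h
  · intro d d' hd
    obtain ⟨l, hl⟩ := Function.ne_iff.mp hd
    simp only [H, conjTranspose_piMatrix, piMatrix_mul, trace_piMatrix]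
    exact Finset.prod_eq_zero (Finset.mem_univ l) (horth l _ _ hl)
  · simp only [hH]
    exact sum_prod_errProb A P.infoPos fun _ => 1
  · intro x
    simp only [H, sum_bitSign_smul_piMatrix, conjTranspose_piMatrix, piMatrix_mul, ← hη]
    -- In the protocol the INFO bits are sent in the `z` basis, the one in which the probe states
    -- were decomposed.
    have hb : ∀ l, P.info P.realBases l = 0 := P.b_infoPos
    unfold eveState piMatrix
    simp only [hb]
    rfl

lemma expectedDeltaEve_le {PC : Matrix (Fin r) (Fin n) (ZMod 2)}
    {PK : Matrix (Fin m) (Fin n) (ZMod 2)} (hrows : LinearIndependent (ZMod 2) (codeRows PC PK))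
    (paz pax : ℝ) (k k' : BitString m) :
    expectedDeltaEve A PC PK paz pax k k' ≤
      ∑ P, 2 * m * Real.sqrt (tailWeight (infoErrProb A P) (minDist PC PK)) *
        ((Fintype.card (BitPartition n nz nx) : ℝ)⁻¹ * passProb A paz pax P) := by
  classical
  unfold expectedDeltaEve
  refine Finset.sum_le_sum fun P _ => ?_
  set B := 2 * m * Real.sqrt (tailWeight (infoErrProb A P) (minDist PC PK)) with hB
  let g : BitString nz → BitString nx → ℝ := fun u w =>
    B * if errorRate u ≤ paz ∧ errorRate w ≤ pax then 1 else 0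
  have hsum := sum_eventProb_realBases A PC P g
  have hg : (Fintype.card (BitPartition n nz nx) : ℝ)⁻¹ *
      (∑ u : BitString nz, ∑ w : BitString nx, g u w *
        ((∏ l, A.errProb (P.testZPos l) 0 (u l)) * ∏ l, A.errProb (P.testXPos l) 1 (w l))) =
      B * ((Fintype.card (BitPartition n nz nx) : ℝ)⁻¹ * passProb A paz pax P) := by
    simp only [g, passProb, mul_assoc B, ← Finset.mul_sum]
    ring
  rw [← hg, ← hsum]
  refine Finset.sum_le_sum fun ξ _ => Finset.sum_le_sum fun cz _ => Finset.sum_le_sum fun cb _ =>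
    mul_le_mul_of_nonneg_right ?_ (eventProb_nonneg A _ _)
  simp only [deltaEve, g]
  split_ifs
  · rw [mul_one]
    exact traceDist_eveKeyState_le A P hrows ξ k k'
  · rw [mul_zero]

end Main

end

end BB84InfoZ

/-! ### Averaging over the partitions -/

theorem mainTheorem3 (n nz nx r m : ℕ) (hnz : 0 < nz) (hnx : 0 < nx) (hm : 0 < m)
    (PC : Matrix (Fin r) (Fin n) (ZMod 2)) (PK : Matrix (Fin m) (Fin n) (ZMod 2))
    (hrows : LinearIndependent (ZMod 2) (BB84InfoZ.codeRows PC PK))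
    (paz pax : ℝ) (A : BB84InfoZ.CollectiveAttack (n + nz + nx))
    (k k' : BB84InfoZ.BitString m) :
    BB84InfoZ.expectedDeltaEve A PC PK paz pax k k' ≤
      2 * (m : ℝ) * Real.sqrt
        (BB84InfoZ.eventProb A BB84InfoZ.BitPartition.virtualBases (fun P i iB =>
          BB84InfoZ.errorRate (P.info (i + iB)) ≥
              (BB84InfoZ.minDist PC PK : ℝ) / (2 * (n : ℝ)) ∧
            BB84InfoZ.errorRate (P.testZ (i + iB)) ≤ paz ∧
            BB84InfoZ.errorRate (P.testX (i + iB)) ≤ pax)) := by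
  have hn : 0 < n := by
    have : r + m ≤ n := by simpa using hrows.fintype_card_le_finrank
    omega
  rw [BB84InfoZ.eventProb_virtualBases A hn]
  refine (BB84InfoZ.expectedDeltaEve_le A hrows paz pax k k').trans ?_
  set p : ℝ := (Fintype.card (BB84InfoZ.BitPartition n nz nx) : ℝ)⁻¹ with hp
  have hp0 : 0 ≤ p := by positivity
  set T := BB84InfoZ.passProb A paz pax with hT
  set Q := fun P => BB84InfoZ.tailWeight (BB84InfoZ.infoErrProb A P) (BB84InfoZ.minDist PC PK)
    with hQ
  have hT0 : ∀ P, 0 ≤ T P := BB84InfoZ.passProb_nonneg A paz pax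
  have hQ0 : ∀ P, 0 ≤ Q P := fun P => BB84InfoZ.tailWeight_nonneg A P _
  have hone : ∑ P, p * T P ≤ 1 := by
    calc ∑ P, p * T P ≤ ∑ _P : BB84InfoZ.BitPartition n nz nx, p := Finset.sum_le_sum fun P _ =>
          mul_le_of_le_one_right hp0 (BB84InfoZ.passProb_le_one A paz pax P)
      _ ≤ 1 := by
          rw [Finset.sum_const, Finset.card_univ, nsmul_eq_mul]
          -- Valid also for cardinality 0, where the inverse is 0, so no partition need be
          -- exhibited.
          exact mul_inv_le_one
  -- The weight p T is split into two roots: one factor has square sum at most 1, the other the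
  -- probability of the virtual event.
  have hterm : ∀ P, 2 * (m : ℝ) * Real.sqrt (Q P) * (p * T P) =
      2 * m * (Real.sqrt (p * T P) * Real.sqrt (p * (Q P * T P))) := by
    intro P
    rw [show p * (Q P * T P) = (p * T P) * Q P by ring,
      Real.sqrt_mul (mul_nonneg hp0 (hT0 P)), ← mul_assoc (Real.sqrt _),
      Real.mul_self_sqrt (mul_nonneg hp0 (hT0 P))]
    ring
  calc ∑ P, 2 * (m : ℝ) * Real.sqrt (Q P) * (p * T P)
      = 2 * m * ∑ P, Real.sqrt (p * T P) * Real.sqrt (p * (Q P * T P)) := by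
        rw [Finset.mul_sum]
        exact Finset.sum_congr rfl fun P _ => hterm P
    _ ≤ 2 * m * (Real.sqrt (∑ P, p * T P) * Real.sqrt (∑ P, p * (Q P * T P))) := by
        refine mul_le_mul_of_nonneg_left ?_ (by positivity)
        exact Real.sum_sqrt_mul_sqrt_le _ (fun P => mul_nonneg hp0 (hT0 P))
          (fun P => mul_nonneg hp0 (mul_nonneg (hQ0 P) (hT0 P)))
    _ ≤ 2 * m * Real.sqrt (∑ P, p * (Q P * T P)) := by
        refine mul_le_mul_of_nonneg_left ?_ (by positivity)
        exact mul_le_of_le_one_left (Real.sqrt_nonneg _) (Real.sqrt_le_one.mpr hone)
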